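/- Let $k$ be a field. Let $\mathrm{BiAlg}$ and $\mathrm{HopfAlg}$ be the categories of bialgebras and of Hopf algebras over $k$, with bialgebra maps as morphisms in both, and let $\mathrm{SHopfAlg}$ be the full subcategory of $\mathrm{HopfAlg}$ consisting of the Hopf algebras with bijective antipode. The inclusion functor $j:\mathrm{HopfAlg}\to\mathrm{BiAlg}$ has a left adjoint $H^*$ and a right adjoint $H_*$, and the inclusion functor $i:\mathrm{SHopfAlg}\to\mathrm{HopfAlg}$ has a left adjoint $K^*$ and a right adjoint $K_*$. For any choice of these adjoints, the units $B\to H^*(B)$, $H\to K^*(H)$ and the counits $H_*(B)\to B$, $K_*(H)\to H$ of the adjunctions satisfy the following (epimorphisms and monomorphisms are meant in the categorical sense). (a) Let $B$ be a bialgebra that is not Hopf, i.e. that has no antipode. If $B$ is (isomorphic to) a sub-bialgebra of a Hopf algebra, then $B\to H^*(B)$ is injective, not surjective, and an epimorphism in $\mathrm{BiAlg}$. If $B$ is a quotient bialgebra of a Hopf algebra, then $H_*(B)\to B$ is surjective, not injective, and a monomorphism in $\mathrm{BiAlg}$. (b) Let $H$ be a Hopf algebra whose antipode is not bijective. If $H$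 is (isomorphic to) a Hopf subalgebra of a Hopf algebra with bijective antipode, then $H\to K^*(H)$ is injective, not surjective, and an epimorphism in $\mathrm{HopfAlg}$. If $H$ is a quotient of a Hopf algebra with bijective antipode, then $K_*(H)\to H$ is surjective, not injective, and a monomorphism in $\mathrm{HopfAlg}$. -/

import Mathlib

open CategoryTheory

universe u

noncomputable section

/-- The inclusion functor `j` of the category of Hopf algebras over `k` into the category of
bialgebras over `k`. (Morphisms of Hopf algebras are the bialgebra maps; these automatically
commute with antipodes.) -/
abbrev hopfInclusion (k : Type u) [Field k] : HopfAlgCat.{u} k ⥤ BialgCat.{u} k :=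
  forget₂ (HopfAlgCat.{u} k) (BialgCat.{u} k)

/-- The property of a Hopf algebra of having a bijective antipode. -/
def HasBijectiveAntipode (k : Type u) [Field k] : ObjectProperty (HopfAlgCat.{u} k) :=
  fun H => Function.Bijective (HopfAlgebraStruct.antipode k : H →ₗ[k] H)

/-- The category of Hopf algebras over `k` with bijective antipode, a full subcategory of the
category of Hopf algebras over `k`. -/
abbrev SHopfAlgCat (k : Type u) [Field k] := (HasBijectiveAntipode k).FullSubcategory

/-- The inclusion functor `i` of the category of Hopf algebras with bijective antipode into the
category of Hopf algebras. -/
abbrev shopfInclusion (k : Type u) [Field k] : SHopfAlgCat k ⥤ HopfAlgCat.{u} k :=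
  (HasBijectiveAntipode k).ι

/-- A bialgebra `B` is Hopf if it admits an antipode, i.e. a two-sided convolution inverse of the
identity of `B`. -/
def IsHopf (k : Type u) [Field k] (B : Type u) [Ring B] [Bialgebra k B] : Prop :=
  ∃ S : B →ₗ[k] B,
    LinearMap.mul' k B ∘ₗ S.rTensor B ∘ₗ Coalgebra.comul =
      Algebra.linearMap k B ∘ₗ Coalgebra.counit ∧
    LinearMap.mul' k B ∘ₗ S.lTensor B ∘ₗ Coalgebra.comul =
      Algebra.linearMap k B ∘ₗ Coalgebra.counit

end

/-! Injectivity and non-surjectivity are formal. An embedding of B into a Hopf algebra factors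
through the unit, so the unit is injective; if it were also surjective it would be an isomorphism
and B would inherit an antipode. The counits are dual, and bijectivity of the antipode transfers
along isomorphisms in the same way. What has to be built are the four adjoints, with epic units and
monic counits.

Left adjoints. A bialgebra map f : B → H yields algebra maps x_n = S^{2n} f and antimaps y_n =
S^{2n+1} f, each the convolution inverse of its predecessor, alternately in H and in the opposite
algebra. The index runs over ℕ, or over ℤ if S is bijective. The envelope `ChainAlg` carries the
universal chain of this kind. As convolution inverses are unique, x_0 determines the chain
(`AntipodeChain.ext_of_base`). So algebra maps out of the envelope are determined by their
restriction along x_0, although its image need not generate. This makes the unit epic, and it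
reduces the coalgebra axioms to the image of B.

Right adjoints. For f : H → B, evaluate all convolution products of functionals g ∘ f ∘ S^{±1} ∘ ...
∘ S^{±1} on H. These coordinates (`coord`) are preserved by Hopf maps over B, and their common
kernel is a Hopf ideal inside ker f. Dividing by it gives an object that embeds in one fixed
function space, so up to isomorphism such objects form a set. The reduced quotient of the coproduct
of all of them is cofree: existence holds because every object maps to one of them, uniqueness
because coordinates separate points.

Monic counits then follow formally from epic units (`mono_counit_app_of_epi_unit`). -/

noncomputable section

open scoped TensorProduct
open WithConv MulOpposite

/-! ### Convolution inverses and the antipode -/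

section Convolution

variable {k : Type*} [CommRing k]

/-- Two linear maps from a coalgebra to an algebra are mutually inverse for convolution. -/
def ConvInv {C E : Type*} [AddCommGroup C] [Module k C] [Coalgebra k C] [Ring E] [Algebra k E]
    (f g : C →ₗ[k] E) : Prop :=
  toConv f * toConv g = 1 ∧ toConv g * toConv f = 1

namespace ConvInv

variable {C D E F : Type*} [AddCommGroup C] [Module k C] [Coalgebra k C]
  [AddCommGroup D] [Module k D] [Coalgebra k D]
  [Ring E] [Algebra k E] [Ring F] [Algebra k F] {f g f' g' : C →ₗ[k] E}

theorem symm (h : ConvInv f g) : ConvInv g f := ⟨h.2, h.1⟩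

theorem eq_right (h : ConvInv f g) (h' : ConvInv f g') : g = g' :=
  toConv_injective (left_inv_eq_right_inv h.2 h'.1)

theorem eq_left (h : ConvInv f g) (h' : ConvInv f' g) : f = f' :=
  h.symm.eq_right h'.symm

theorem mul (h : ConvInv f g) (h' : ConvInv f' g') :
    ConvInv (toConv f * toConv f').ofConv (toConv g' * toConv g).ofConv := by
  constructor
  · change toConv f * toConv f' * (toConv g' * toConv g) = 1
    rw [mul_assoc, ← mul_assoc (toConv f'), h'.1, one_mul, h.1]
  · change toConv g' * toConv g * (toConv f * toConv f') = 1
    rw [mul_assoc, ← mul_assoc (toConv g), h.2, one_mul, h'.2]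

theorem _root_.toConv_comp_mul (φ : E →ₐ[k] F) (f g : C →ₗ[k] E) :
    toConv (φ.toLinearMap ∘ₗ f) * toConv (φ.toLinearMap ∘ₗ g) =
      toConv (φ.toLinearMap ∘ₗ (toConv f * toConv g).ofConv) := by
  rw [LinearMap.algHom_comp_convMul_distrib]

theorem _root_.toConv_mul_comp (f g : C →ₗ[k] E) (ψ : D →ₗc[k] C) :
    toConv (f ∘ₗ ψ.toLinearMap) * toConv (g ∘ₗ ψ.toLinearMap) =
      toConv ((toConv f * toConv g).ofConv ∘ₗ ψ.toLinearMap) := by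
  rw [LinearMap.convMul_comp_coalgHom_distrib]

theorem algHom_comp (φ : E →ₐ[k] F) (h : ConvInv f g) :
    ConvInv (φ.toLinearMap ∘ₗ f) (φ.toLinearMap ∘ₗ g) := by
  have e : toConv (φ.toLinearMap ∘ₗ (1 : WithConv (C →ₗ[k] E)).ofConv) = 1 := by
    ext; simp
  constructor
  · rw [toConv_comp_mul, h.1, e]
  · rw [toConv_comp_mul, h.2, e]

theorem comp_coalgHom (h : ConvInv f g) (ψ : D →ₗc[k] C) :
    ConvInv (f ∘ₗ ψ.toLinearMap) (g ∘ₗ ψ.toLinearMap) := by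
  have e : toConv ((1 : WithConv (C →ₗ[k] E)).ofConv ∘ₗ ψ.toLinearMap) = 1 := by
    ext; simp
  constructor
  · rw [toConv_mul_comp, h.1, e]
  · rw [toConv_mul_comp, h.2, e]

/-- With a fixed representative of each comultiplication the condition becomes a family of
polynomial identities in the values of f and g, which can be imposed as relations on free
generators. -/
theorem iff_sum : ConvInv f g ↔ ∀ c : C,
    (∑ i ∈ (Coalgebra.Repr.arbitrary k c).index, f ((Coalgebra.Repr.arbitrary k c).left i) *
      g ((Coalgebra.Repr.arbitrary k c).right i) = algebraMap k E (Coalgebra.counit c)) ∧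
    (∑ i ∈ (Coalgebra.Repr.arbitrary k c).index, g ((Coalgebra.Repr.arbitrary k c).left i) *
      f ((Coalgebra.Repr.arbitrary k c).right i) = algebraMap k E (Coalgebra.counit c)) := by
  have key (p q : C →ₗ[k] E) : toConv p * toConv q = 1 ↔ ∀ c : C,
      ∑ i ∈ (Coalgebra.Repr.arbitrary k c).index, p ((Coalgebra.Repr.arbitrary k c).left i) *
      q ((Coalgebra.Repr.arbitrary k c).right i) = algebraMap k E (Coalgebra.counit c) := by
    constructor
    · intro h c
      have := congr($h c)
      rw [(Coalgebra.Repr.arbitrary k c).convMul_apply] at this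
      simpa using this
    · intro h
      ext c
      rw [(Coalgebra.Repr.arbitrary k c).convMul_apply]
      simpa using h c
  rw [ConvInv, key, key, forall_and]

end ConvInv

theorem convInv_counit {C : Type*} [AddCommGroup C] [Module k C] [Coalgebra k C]
    {E : Type*} [Ring E] [Algebra k E] :
    ConvInv (k := k) (Algebra.linearMap k E ∘ₗ Coalgebra.counit : C →ₗ[k] E)
      (Algebra.linearMap k E ∘ₗ Coalgebra.counit) :=
  ⟨one_mul (1 : WithConv (C →ₗ[k] E)), one_mul (1 : WithConv (C →ₗ[k] E))⟩

theorem convInv_antipode (H : Type*) [Ring H] [HopfAlgebra k H] :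
    ConvInv (LinearMap.id : H →ₗ[k] H) (HopfAlgebra.antipode k) :=
  ⟨LinearMap.id_mul_antipode, LinearMap.antipode_mul_id⟩

variable {H H' : Type*} [Ring H] [HopfAlgebra k H] [Ring H'] [HopfAlgebra k H']

/-- Both sides are convolution inverses of f. -/
theorem BialgHom.map_antipode (f : H →ₐc[k] H') (h : H) :
    f (HopfAlgebra.antipode k h) = HopfAlgebra.antipode k (f h) := by
  have h1 := (convInv_antipode (k := k) H).algHom_comp (f : H →ₐ[k] H')
  have h2 := (convInv_antipode (k := k) H').comp_coalgHom (f : H →ₗc[k] H')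
  exact congr($(h1.eq_right h2) h)

/-- The antipode reverses convolution products of functionals. -/
theorem convMul_comp_antipode {E : Type*} [CommRing E] [Algebra k E] (a b : H →ₗ[k] E) :
    (toConv a * toConv b).ofConv ∘ₗ HopfAlgebra.antipode k =
      (toConv (b ∘ₗ HopfAlgebra.antipode k) * toConv (a ∘ₗ HopfAlgebra.antipode k)).ofConv := by
  have h0 := convInv_antipode (k := k) H
  let i₁ : H →ₐ[k] H ⊗[k] H := Algebra.TensorProduct.includeLeft
  let i₂ : H →ₐ[k] H ⊗[k] H := Algebra.TensorProduct.includeRight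
  -- The comultiplication is the convolution product i₁ * i₂, so Δ ∘ S and (i₂ ∘ S) * (i₁ ∘ S) are
  -- both convolution inverses of it. Applying a ⊗ b and multiplying in the commutative E gives the
  -- claim.
  have h1 := (h0.algHom_comp i₁).mul (h0.algHom_comp i₂)
  have h2 := h0.algHom_comp (Bialgebra.comulAlgHom k H)
  have e : (toConv (i₁.toLinearMap ∘ₗ LinearMap.id) *
      toConv (i₂.toLinearMap ∘ₗ LinearMap.id)).ofConv =
      (Bialgebra.comulAlgHom k H).toLinearMap ∘ₗ LinearMap.id := by
    ext c
    change (toConv (i₁.toLinearMap ∘ₗ LinearMap.id) *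
      toConv (i₂.toLinearMap ∘ₗ LinearMap.id)) c = _
    rw [(Coalgebra.Repr.arbitrary k c).convMul_apply]
    simp [i₁, i₂, (Coalgebra.Repr.arbitrary k c).eq]
  rw [e] at h1
  have h3 := h2.eq_right h1
  ext c
  have h4 := congr(LinearMap.mul' k E (TensorProduct.map a b ($h3 c)))
  refine h4.trans ?_
  change LinearMap.mul' k E (TensorProduct.map a b
    ((toConv (i₂.toLinearMap ∘ₗ HopfAlgebra.antipode k) *
      toConv (i₁.toLinearMap ∘ₗ HopfAlgebra.antipode k)) c)) =
    (toConv (b ∘ₗ HopfAlgebra.antipode k) * toConv (a ∘ₗ HopfAlgebra.antipode k)) c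
  rw [(Coalgebra.Repr.arbitrary k c).convMul_apply, (Coalgebra.Repr.arbitrary k c).convMul_apply]
  simp [i₁, i₂, mul_comm]

end Convolution

/-! ### Bialgebra structures determined on a jointly epic family -/

section Generators

variable {k : Type u} [Field k]

/-- A family of algebra maps with common codomain is jointly epi. -/
def JointlyEpi {I : Type*} {A : I → Type u} {Q : Type u} [∀ i, Ring (A i)] [∀ i, Algebra k (A i)]
    [Ring Q] [Algebra k Q] (φ : ∀ i, A i →ₐ[k] Q) : Prop :=
  ∀ ⦃E : Type u⦄ [Ring E] [Algebra k E] (f g : Q →ₐ[k] E),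
    (∀ i, f.comp (φ i) = g.comp (φ i)) → f = g

variable {I : Type*} {A : I → Type u} {Q : Type u} [∀ i, Ring (A i)] [∀ i, Bialgebra k (A i)]
    [Ring Q] [Algebra k Q]

variable {φ : ∀ i, A i →ₐ[k] Q} {Δ : Q →ₐ[k] Q ⊗[k] Q} {ε : Q →ₐ[k] k}

theorem JointlyEpi.coassoc (hφ : JointlyEpi φ)
    (hΔ : ∀ i, Δ.comp (φ i) = (Algebra.TensorProduct.map (φ i) (φ i)).comp
      (Bialgebra.comulAlgHom k (A i))) :
    (Algebra.TensorProduct.assoc k k k Q Q Q).toAlgHom.comp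
      ((Algebra.TensorProduct.map Δ (.id k Q)).comp Δ)
      = (Algebra.TensorProduct.map (.id k Q) Δ).comp Δ := by
  have hΔ' (i) : Δ.toLinearMap ∘ₗ (φ i).toLinearMap =
      TensorProduct.map (φ i).toLinearMap (φ i).toLinearMap ∘ₗ Coalgebra.comul :=
    congr(($(hΔ i)).toLinearMap)
  refine hφ _ _ fun i => AlgHom.toLinearMap_injective ?_
  simp only [coassoc_simps, AlgHom.comp_toLinearMap, Algebra.TensorProduct.toLinearMap_map, hΔ']
  simp [coassoc_simps]

theorem JointlyEpi.counit_comul (hφ : JointlyEpi φ)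
    (hΔ : ∀ i, Δ.comp (φ i) = (Algebra.TensorProduct.map (φ i) (φ i)).comp
      (Bialgebra.comulAlgHom k (A i)))
    (hε : ∀ i, ε.comp (φ i) = Bialgebra.counitAlgHom k (A i)) :
    (Algebra.TensorProduct.map ε (.id k Q)).comp Δ
      = (Algebra.TensorProduct.lid k Q).symm ∧
    (Algebra.TensorProduct.map (.id k Q) ε).comp Δ = (Algebra.TensorProduct.rid k k Q).symm := by
  have hΔ' (i) : Δ.toLinearMap ∘ₗ (φ i).toLinearMap =
      TensorProduct.map (φ i).toLinearMap (φ i).toLinearMap ∘ₗ Coalgebra.comul :=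
    congr(($(hΔ i)).toLinearMap)
  have hε' (i) : ε.toLinearMap ∘ₗ (φ i).toLinearMap = Coalgebra.counit :=
    congr(($(hε i)).toLinearMap)
  constructor <;> refine hφ _ _ fun i => AlgHom.toLinearMap_injective ?_ <;>
    simp only [coassoc_simps, AlgHom.comp_toLinearMap, Algebra.TensorProduct.toLinearMap_map,
      hΔ', hε']
  · rw [CoassocSimps.map_counit_comp_comul_left]; rfl
  · rw [CoassocSimps.map_counit_comp_comul_right]; rfl

/-- A bialgebra structure on an algebra that receives a jointly epi family of algebra maps from
bialgebras. -/
abbrev Bialgebra.ofJointlyEpi (φ : ∀ i, A i →ₐ[k] Q) (hφ : JointlyEpi φ)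
    (Δ : Q →ₐ[k] Q ⊗[k] Q) (ε : Q →ₐ[k] k)
    (hΔ : ∀ i, Δ.comp (φ i) = (Algebra.TensorProduct.map (φ i) (φ i)).comp
      (Bialgebra.comulAlgHom k (A i)))
    (hε : ∀ i, ε.comp (φ i) = Bialgebra.counitAlgHom k (A i)) : Bialgebra k Q :=
  .ofAlgHom Δ ε (hφ.coassoc hΔ) (hφ.counit_comul hΔ hε).1 (hφ.counit_comul hΔ hε).2

end Generators

/-! ### Antipodes checked on algebra generators -/

section Antipode

variable {k : Type u} [Field k] {Q : Type u} [Ring Q] [Bialgebra k Q]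

/-- An algebra antihomomorphism viewed as a linear endomorphism. -/
abbrev unopLin {A : Type*} [Ring A] [Algebra k A] {E : Type*} [Ring E] [Algebra k E]
    (σ : A →ₐ[k] Eᵐᵒᵖ) : A →ₗ[k] E :=
  (opLinearEquiv k).symm.toLinearMap ∘ₗ σ.toLinearMap

theorem mul_map_comul (f g : Q →ₗ[k] Q) (q : Q) :
    (toConv f * toConv g) q = ∑ i ∈ (Coalgebra.Repr.arbitrary k q).index,
      f ((Coalgebra.Repr.arbitrary k q).left i) * g ((Coalgebra.Repr.arbitrary k q).right i) :=
  (Coalgebra.Repr.arbitrary k q).convMul_apply _ _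

/-- The elements at which an algebra antihomomorphism satisfies the antipode axioms. -/
def antipodeLocus (σ : Q →ₐ[k] Qᵐᵒᵖ) : Subalgebra k Q where
  carrier := {q | (toConv (unopLin σ) * toConv LinearMap.id : WithConv (Q →ₗ[k] Q)) q =
      algebraMap k Q (Coalgebra.counit q) ∧
    (toConv LinearMap.id * toConv (unopLin σ) : WithConv (Q →ₗ[k] Q)) q =
      algebraMap k Q (Coalgebra.counit q)}
  mul_mem' := by
    rintro a b ⟨ha, ha'⟩ ⟨hb, hb'⟩
    rw [mul_map_comul] at ha hb ha' hb'
    simp only [LinearMap.comp_apply, LinearMap.id_apply, AlgHom.toLinearMap_apply,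
      LinearEquiv.coe_coe, coe_opLinearEquiv_symm] at ha hb ha' hb'
    constructor <;>
      rw [((Coalgebra.Repr.arbitrary k a).mul (Coalgebra.Repr.arbitrary k b)).convMul_apply] <;>
      simp only [Coalgebra.Repr.mul_index, Coalgebra.Repr.mul_left, Coalgebra.Repr.mul_right,
        Finset.sum_product, LinearMap.comp_apply, LinearMap.id_apply,
        AlgHom.toLinearMap_apply, LinearEquiv.coe_coe, coe_opLinearEquiv_symm, map_mul, unop_mul,
        Bialgebra.counit_mul]
    -- In S(b₁)S(a₁)a₂b₂ the inner sum over a is the scalar ε(a), which is central; the sum over b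
    -- then collapses. The other axiom collapses b₁S(b₂) first.
    · rw [Finset.sum_comm, ← hb, Finset.mul_sum]
      refine Finset.sum_congr rfl fun j _ => ?_
      rw [← mul_assoc, Algebra.commutes, ← ha]
      simp only [mul_assoc, Finset.mul_sum, Finset.sum_mul]
    · rw [← ha', Finset.sum_mul]
      refine Finset.sum_congr rfl fun i _ => ?_
      rw [mul_assoc, ← Algebra.commutes, ← mul_assoc, ← hb']
      simp only [mul_assoc, Finset.mul_sum, Finset.sum_mul]
  add_mem' := by
    rintro a b ⟨ha, ha'⟩ ⟨hb, hb'⟩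
    constructor
    · have := congr($ha + $hb); simpa using! this
    · have := congr($ha' + $hb'); simpa using! this
  algebraMap_mem' r := by
    constructor <;> simp [Algebra.TensorProduct.one_def, Algebra.algebraMap_eq_smul_one]

/-- A bialgebra is a Hopf algebra when an algebra antihomomorphism satisfies the antipode axioms
on algebra generators. -/
abbrev HopfAlgebra.ofGenerators (σ : Q →ₐ[k] Qᵐᵒᵖ) (h : antipodeLocus σ = ⊤) :
    HopfAlgebra k Q :=
  .ofConvInverse (unopLin σ)
    (by ext q; exact (h.ge (Algebra.mem_top : q ∈ ⊤)).1)
    (by ext q; exact (h.ge (Algebra.mem_top : q ∈ ⊤)).2)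

theorem mem_antipodeLocus_of_convInv {σ : Q →ₐ[k] Qᵐᵒᵖ} {C : Type*} [AddCommGroup C]
    [Module k C] [Coalgebra k C] (f : C →ₗc[k] Q)
    (h : ConvInv f.toLinearMap (unopLin σ ∘ₗ f.toLinearMap)) (c : C) : f c ∈ antipodeLocus σ := by
  constructor
  · have h1 := h.2
    have h2 := toConv_mul_comp (unopLin σ) LinearMap.id f
    rw [LinearMap.id_comp, h1] at h2
    refine congr($h2 c).symm.trans ?_
    simp
  · have h1 := h.1
    have h2 := toConv_mul_comp LinearMap.id (unopLin σ) f
    rw [LinearMap.id_comp, h1] at h2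
    refine congr($h2 c).symm.trans ?_
    simp

end Antipode

/-! ### Algebras presented by all identities valid in a class of models -/

section UnivAlg

variable (k : Type u) [Field k] (X : Type u)
  (𝒞 : ∀ (E : Type u) [Ring E] [Algebra k E], (X → E) → Prop)

/-- The identities in free variables that hold in all models of `𝒞`. -/
def UnivRel (a b : FreeAlgebra k X) : Prop :=
  ∀ (E : Type u) [Ring E] [Algebra k E] (v : X → E), 𝒞 E v →
    FreeAlgebra.lift k v a = FreeAlgebra.lift k v b

/-- The algebra generated by `X` subject to all identities that hold in all models of `𝒞`. -/
def UnivAlg : Type u := RingQuot (UnivRel k X 𝒞)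

namespace UnivAlg

instance : Ring (UnivAlg k X 𝒞) := inferInstanceAs (Ring (RingQuot _))
instance : Algebra k (UnivAlg k X 𝒞) := inferInstanceAs (Algebra k (RingQuot _))

/-- The quotient map from the free algebra. -/
def mk : FreeAlgebra k X →ₐ[k] UnivAlg k X 𝒞 := RingQuot.mkAlgHom k (UnivRel k X 𝒞)

/-- The generators. -/
def gen (x : X) : UnivAlg k X 𝒞 := mk k X 𝒞 (FreeAlgebra.ι k x)

variable {k X 𝒞}

theorem mk_eq {a b : FreeAlgebra k X} (h : UnivRel k X 𝒞 a b) : mk k X 𝒞 a = mk k X 𝒞 b :=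
  RingQuot.mkAlgHom_rel k h

variable {E : Type u} [Ring E] [Algebra k E]

/-- The universal property. -/
def lift {v : X → E} (h : 𝒞 E v) : UnivAlg k X 𝒞 →ₐ[k] E :=
  RingQuot.liftAlgHom k ⟨FreeAlgebra.lift k v, fun _ _ hr => hr E v h⟩

@[simp]
theorem lift_gen {v : X → E} (h : 𝒞 E v) (x : X) : lift h (gen k X 𝒞 x) = v x :=
  (RingQuot.liftAlgHom_mkAlgHom_apply k _ _ _).trans (by simp)

theorem mem_of_gen (S : Subalgebra k (UnivAlg k X 𝒞)) (h : ∀ x, gen k X 𝒞 x ∈ S)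
    (q : UnivAlg k X 𝒞) : q ∈ S := by
  obtain ⟨a, rfl⟩ := RingQuot.mkAlgHom_surjective k (UnivRel k X 𝒞) q
  change mk k X 𝒞 a ∈ S
  induction a using FreeAlgebra.induction with
  | grade0 r => simp
  | grade1 x => exact h x
  | mul a b ha hb => rw [map_mul]; exact S.mul_mem ha hb
  | add a b ha hb => rw [map_add]; exact S.add_mem ha hb

theorem hom_ext {f g : UnivAlg k X 𝒞 →ₐ[k] E} (h : ∀ x, f (gen k X 𝒞 x) = g (gen k X 𝒞 x)) :
    f = g :=
  AlgHom.ext fun q => mem_of_gen (AlgHom.equalizer f g) h q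

end UnivAlg

end UnivAlg

/-! ### Antipode chains and the universal chain -/

section Chains

variable {k : Type u} [Field k] {N : Type} {s : N → N} {B : Type u} [Ring B] [Bialgebra k B]

/-- An algebra map viewed as a linear map to the opposite algebra. -/
abbrev opLin {E : Type*} [Ring E] [Algebra k E] (f : B →ₐ[k] E) : B →ₗ[k] Eᵐᵒᵖ :=
  (opLinearEquiv k).toLinearMap ∘ₗ f.toLinearMap

variable (k s B) in
/-- A chain of algebra maps `x n` and algebra antimaps `y n` from a bialgebra to an algebra, in
which `y n` is the convolution inverse of `x n` and `x (s n)` is the convolution inverse of `y n`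
with respect to the opposite multiplication. -/
structure AntipodeChain (E : Type*) [Ring E] [Algebra k E] where
  /-- The algebra maps of the chain. -/
  x : N → B →ₐ[k] E
  /-- The algebra antimaps of the chain. -/
  y : N → B →ₐ[k] Eᵐᵒᵖ
  xy (n) : ConvInv (x n).toLinearMap (unopLin (y n))
  yx (n) : ConvInv (y n).toLinearMap (opLin (x (s n)))

namespace AntipodeChain

variable {E F : Type*} [Ring E] [Algebra k E] [Ring F] [Algebra k F]

/-- Uniqueness of convolution inverses carries equality from x n to y n to x (s n), and also
backwards. The hypothesis `hN` is induction in both directions from z, valid for ℕ and for ℤ. -/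
theorem ext_of_base {z : N} (hN : ∀ p : N → Prop, p z → (∀ n, p n ↔ p (s n)) → ∀ n, p n)
    {c d : AntipodeChain k s B E} (h : c.x z = d.x z) : c = d := by
  have hy {n} (h : c.x n = d.x n) : c.y n = d.y n := by
    have h1 := c.xy n
    rw [h] at h1
    have h2 := h1.eq_right (d.xy n)
    ext b
    exact unop_injective congr($h2 b)
  have hx' {n} (h : c.y n = d.y n) : c.x n = d.x n := by
    have h1 := c.xy n
    rw [h] at h1
    have h2 := h1.eq_left (d.xy n)
    ext b
    exact congr($h2 b)
  have hx {n} (h : c.y n = d.y n) : c.x (s n) = d.x (s n) := by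
    have h1 := c.yx n
    rw [h] at h1
    have h2 := h1.eq_right (d.yx n)
    ext b
    exact op_injective congr($h2 b)
  have hy' {n} (h : c.x (s n) = d.x (s n)) : c.y n = d.y n := by
    have h1 := c.yx n
    rw [h] at h1
    exact AlgHom.toLinearMap_injective (h1.eq_left (d.yx n))
  have key : ∀ n, c.x n = d.x n := hN _ h fun n => ⟨fun h => hx (hy h), fun h => hx' (hy' h)⟩
  cases c; cases d
  congr
  · exact funext key
  · exact funext fun n => hy (key n)

/-- The image of a chain under an algebra map. -/
def map (φ : E →ₐ[k] F) (c : AntipodeChain k s B E) : AntipodeChain k s B F where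
  x n := φ.comp (c.x n)
  y n := (AlgHom.op φ).comp (c.y n)
  xy n := (c.xy n).algHom_comp φ
  yx n := (c.yx n).algHom_comp (AlgHom.op φ)

/-- The shifted chain in the opposite algebra. -/
def shift (c : AntipodeChain k s B E) : AntipodeChain k s B Eᵐᵒᵖ where
  x n := c.y n
  y n := (AlgEquiv.opOp k E).toAlgHom.comp (c.x (s n))
  xy n := c.yx n
  yx n := (c.xy (s n)).algHom_comp (AlgEquiv.opOp k E).toAlgHom

/-- The chain in the opposite algebra, shifted in the other direction. -/
def unshift (p : N → N) (hps : ∀ n, p (s n) = n) (hsp : ∀ n, s (p n) = n)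
    (c : AntipodeChain k s B E) : AntipodeChain k s B Eᵐᵒᵖ where
  x n := c.y (p n)
  y n := (AlgEquiv.opOp k E).toAlgHom.comp (c.x n)
  xy n := by
    have := c.yx (p n)
    rw [hsp] at this
    exact this
  yx n := by
    rw [hps]
    exact (c.xy n).algHom_comp (AlgEquiv.opOp k E).toAlgHom

variable (k s B) in
/-- The chain given by the counit. -/
def counit : AntipodeChain k s B k where
  x _ := Bialgebra.counitAlgHom k B
  y _ := (Bialgebra.counitAlgHom k B).toOpposite fun _ _ => Commute.all _ _
  xy _ := convInv_counit
  yx _ := convInv_counit (E := kᵐᵒᵖ)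

/-- The tensor square of a chain. -/
def tensor (c : AntipodeChain k s B E) : AntipodeChain k s B (E ⊗[k] E) where
  x n := (Algebra.TensorProduct.map (c.x n) (c.x n)).comp (Bialgebra.comulAlgHom k B)
  y n := (Algebra.TensorProduct.opAlgEquiv k k E E).toAlgHom.comp
    ((Algebra.TensorProduct.map (c.y n) (c.y n)).comp
      ((Algebra.TensorProduct.comm k B B).toAlgHom.comp (Bialgebra.comulAlgHom k B)))
  -- The tensor square of x n is the convolution product of its two coordinate copies; inverting a
  -- product reverses the factors, hence the flip in y n.
  xy n := by
    have h := ((c.xy n).algHom_comp (Algebra.TensorProduct.includeLeft : E →ₐ[k] E ⊗[k] E)).mul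
      ((c.xy n).algHom_comp (Algebra.TensorProduct.includeRight : E →ₐ[k] E ⊗[k] E))
    convert! h using 1
    · ext b
      refine Eq.trans ?_ ((Coalgebra.Repr.arbitrary k b).convMul_apply _ _).symm
      simp [← (Coalgebra.Repr.arbitrary k b).eq]
    · ext b
      refine Eq.trans ?_ ((Coalgebra.Repr.arbitrary k b).convMul_apply _ _).symm
      simp [← (Coalgebra.Repr.arbitrary k b).eq]
  yx n := by
    have h := ((c.yx n).algHom_comp
      (AlgHom.op (Algebra.TensorProduct.includeRight : E →ₐ[k] E ⊗[k] E))).mul ((c.yx n).algHom_comp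
      (AlgHom.op (Algebra.TensorProduct.includeLeft : E →ₐ[k] E ⊗[k] E)))
    convert! h using 1
    · ext b
      refine Eq.trans ?_ ((Coalgebra.Repr.arbitrary k b).convMul_apply _ _).symm
      simp [← (Coalgebra.Repr.arbitrary k b).eq, ← op_mul]
    · ext b
      refine Eq.trans ?_ ((Coalgebra.Repr.arbitrary k b).convMul_apply _ _).symm
      simp [← (Coalgebra.Repr.arbitrary k b).eq, ← op_mul]

/-- The chain in a Hopf algebra obtained from a bialgebra map, given the even powers of the
antipode. -/
def ofHopf {H : Type*} [Ring H] [HopfAlgebra k H] (T : N → H →ₐ[k] H)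
    (hT : ∀ n h, T (s n) h = T n (HopfAlgebra.antipode k (HopfAlgebra.antipode k h)))
    (f : B →ₐc[k] H) : AntipodeChain k s B H where
  x n := (T n).comp f
  y n := (AlgHom.op (T n)).comp ((HopfAlgebra.antipodeAlgHomOp k H).comp f)
  xy n := ((convInv_antipode (k := k) H).comp_coalgHom (f : B →ₗc[k] H)).algHom_comp (T n)
  yx n := by
    have := (((convInv_antipode (k := k) H).comp_coalgHom (f : B →ₗc[k] H)).algHom_comp
      (HopfAlgebra.antipodeAlgHomOp k H)).algHom_comp (AlgHom.op (T n))
    convert! this using 1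
    ext b
    simp [hT]

/-- The values of a chain, indexed by the generators of the universal algebra. -/
def val (c : AntipodeChain k s B E) : (N × B) ⊕ (N × B) → E :=
  Sum.elim (fun p => c.x p.1 p.2) (fun p => unop (c.y p.1 p.2))

end AntipodeChain

variable (k s B) in
/-- The algebra that carries the universal antipode chain. -/
abbrev ChainAlg : Type u :=
  UnivAlg k ((N × B) ⊕ (N × B)) fun E _ _ v => ∃ c : AntipodeChain k s B E, v = c.val

namespace ChainAlg

/-- Equality in the universal algebra holds when it holds for all chains. -/
theorem mk_eq {a b : FreeAlgebra k ((N × B) ⊕ (N × B))}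
    (h : ∀ (E : Type u) [Ring E] [Algebra k E] (c : AntipodeChain k s B E),
      FreeAlgebra.lift k c.val a = FreeAlgebra.lift k c.val b) :
    (UnivAlg.mk k _ _ a : ChainAlg k s B) = UnivAlg.mk k _ _ b := by
  refine UnivAlg.mk_eq fun E _ _ v hv => ?_
  obtain ⟨c, rfl⟩ := hv
  exact h E c

/-- The free variables for the algebra maps of a chain. -/
abbrev freeX (n : N) (b : B) : FreeAlgebra k ((N × B) ⊕ (N × B)) := FreeAlgebra.ι k (.inl (n, b))

/-- The free variables for the algebra antimaps of a chain. -/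
abbrev freeY (n : N) (b : B) : FreeAlgebra k ((N × B) ⊕ (N × B)) := FreeAlgebra.ι k (.inr (n, b))

/-- The universal chain, algebra maps. -/
def genX (n : N) : B →ₐ[k] ChainAlg k s B where
  toFun b := UnivAlg.gen _ _ _ (.inl (n, b))
  map_one' := (mk_eq (a := freeX n 1) (b := 1) (by simp [AntipodeChain.val])).trans (by simp)
  map_mul' a b := (mk_eq (a := freeX n (a * b)) (b := freeX n a * freeX n b)
    (by simp [AntipodeChain.val])).trans (map_mul _ _ _)
  map_zero' := (mk_eq (a := freeX n 0) (b := 0) (by simp [AntipodeChain.val])).trans (by simp)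
  map_add' a b := (mk_eq (a := freeX n (a + b)) (b := freeX n a + freeX n b)
    (by simp [AntipodeChain.val])).trans (map_add _ _ _)
  commutes' r := (mk_eq (a := freeX n (algebraMap k B r)) (b := algebraMap k _ r)
    (by simp [AntipodeChain.val])).trans (by simp)

/-- The universal chain, algebra antimaps. -/
def genY (n : N) : B →ₐ[k] (ChainAlg k s B)ᵐᵒᵖ where
  toFun b := op (UnivAlg.gen _ _ _ (.inr (n, b)))
  map_one' := unop_injective <|
    (mk_eq (a := freeY n 1) (b := 1) (by simp [AntipodeChain.val])).trans (by simp)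
  map_mul' a b := unop_injective <| (mk_eq (a := freeY n (a * b)) (b := freeY n b * freeY n a)
    (by simp [AntipodeChain.val])).trans (map_mul _ _ _)
  map_zero' := unop_injective <|
    (mk_eq (a := freeY n 0) (b := 0) (by simp [AntipodeChain.val])).trans (by simp)
  map_add' a b := unop_injective <| (mk_eq (a := freeY n (a + b)) (b := freeY n a + freeY n b)
    (by simp [AntipodeChain.val])).trans (map_add _ _ _)
  commutes' r := unop_injective <|
    (mk_eq (a := freeY n (algebraMap k B r)) (b := algebraMap k _ r)
    (by simp [AntipodeChain.val])).trans (by simp)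

theorem genX_apply (n : N) (b : B) :
    (genX n b : ChainAlg k s B) = UnivAlg.mk k _ _ (freeX n b) := rfl

theorem genY_apply (n : N) (b : B) :
    (genY n b : (ChainAlg k s B)ᵐᵒᵖ) = op (UnivAlg.mk k _ _ (freeY n b)) := rfl

variable (k s B) in
/-- The universal chain. -/
def univ : AntipodeChain k s B (ChainAlg k s B) where
  x n := genX n
  y n := genY n
  xy n := ConvInv.iff_sum.2 fun b => by
    let R := Coalgebra.Repr.arbitrary k b
    constructor
    · exact Eq.trans (by simp [genX_apply, genY_apply, R])
        ((mk_eq (a := ∑ i ∈ R.index, freeX n (R.left i) * freeY n (R.right i))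
          (b := algebraMap k _ (Coalgebra.counit b)) fun E _ _ c => by
          simpa [AntipodeChain.val, R] using (ConvInv.iff_sum.1 (c.xy n) b).1).trans (by simp))
    · exact Eq.trans (by simp [genX_apply, genY_apply, R])
        ((mk_eq (a := ∑ i ∈ R.index, freeY n (R.left i) * freeX n (R.right i))
          (b := algebraMap k _ (Coalgebra.counit b)) fun E _ _ c => by
          simpa [AntipodeChain.val, R] using (ConvInv.iff_sum.1 (c.xy n) b).2).trans (by simp))
  yx n := ConvInv.iff_sum.2 fun b => by
    let R := Coalgebra.Repr.arbitrary k b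
    constructor
    · refine unop_injective (Eq.trans (by simp [genX_apply, genY_apply, R])
        ((mk_eq (a := ∑ i ∈ R.index, freeX (s n) (R.right i) * freeY n (R.left i))
          (b := algebraMap k _ (Coalgebra.counit b)) fun E _ _ c => ?_).trans (by simp)))
      simpa [AntipodeChain.val, R] using congr(unop $((ConvInv.iff_sum.1 (c.yx n) b).1))
    · refine unop_injective (Eq.trans (by simp [genX_apply, genY_apply, R])
        ((mk_eq (a := ∑ i ∈ R.index, freeY n (R.right i) * freeX (s n) (R.left i))
          (b := algebraMap k _ (Coalgebra.counit b)) fun E _ _ c => ?_).trans (by simp)))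
      simpa [AntipodeChain.val, R] using congr(unop $((ConvInv.iff_sum.1 (c.yx n) b).2))

variable {E : Type u} [Ring E] [Algebra k E]

/-- The universal property of the universal chain. -/
def lift (c : AntipodeChain k s B E) : ChainAlg k s B →ₐ[k] E := UnivAlg.lift ⟨c, rfl⟩

@[simp]
theorem lift_x (c : AntipodeChain k s B E) (n : N) (b : B) :
    lift c ((univ k s B).x n b) = c.x n b :=
  UnivAlg.lift_gen _ _

@[simp]
theorem lift_y (c : AntipodeChain k s B E) (n : N) (b : B) :
    lift c (unop ((univ k s B).y n b)) = unop (c.y n b) :=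
  UnivAlg.lift_gen _ _

/-- The two images of the universal chain agree at z, hence everywhere, and the chain generates the
algebra. -/
theorem hom_ext {z : N} (hN : ∀ p : N → Prop, p z → (∀ n, p n ↔ p (s n)) → ∀ n, p n)
    {f g : ChainAlg k s B →ₐ[k] E} (h : f.comp ((univ k s B).x z) = g.comp ((univ k s B).x z)) :
    f = g := by
  have key : (univ k s B).map f = (univ k s B).map g := AntipodeChain.ext_of_base hN h
  refine UnivAlg.hom_ext fun x => ?_
  rcases x with ⟨n, b⟩ | ⟨n, b⟩
  · exact congr(($key).x n b)
  · exact congr(unop (($key).y n b))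

section Hopf

variable {z : N} (hN : ∀ p : N → Prop, p z → (∀ n, p n ↔ p (s n)) → ∀ n, p n)

/-- The bialgebra structure on the universal algebra. -/
abbrev bialgebra : Bialgebra k (ChainAlg k s B) :=
  Bialgebra.ofJointlyEpi (A := fun _ : Unit => B) (fun _ => (univ k s B).x z)
    (fun _ _ _ _ _ h => hom_ext hN (h ()))
    (lift (univ k s B).tensor) (lift (AntipodeChain.counit k s B))
    (fun _ => AlgHom.ext fun _ => lift_x _ _ _) (fun _ => AlgHom.ext fun _ => lift_x _ _ _)

/-- The locus is only a subalgebra, so being epic from B does not suffice: every x n and y n must be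
checked. -/
theorem antipodeLocus_eq_top : letI : Bialgebra k (ChainAlg k s B) := bialgebra hN
    antipodeLocus (lift (univ k s B).shift) = ⊤ := by
  let : Bialgebra k (ChainAlg k s B) := bialgebra hN
  refine top_le_iff.1 fun q _ => UnivAlg.mem_of_gen _ (fun x => ?_) q
  rcases x with ⟨n, b⟩ | ⟨n, b⟩
  · let f : B →ₗc[k] ChainAlg k s B :=
      { (genX n : B →ₐ[k] ChainAlg k s B).toLinearMap with
        counit_comp := by
          ext b
          exact lift_x (AntipodeChain.counit k s B) n b
        map_comp_comul := by
          ext b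
          exact (lift_x (univ k s B).tensor n b).symm }
    refine mem_antipodeLocus_of_convInv (σ := lift (univ k s B).shift) f ?_ b
    convert! (univ k s B).xy n using 1
    ext b
    exact congr(unop $(lift_x (univ k s B).shift n b))
  -- The map y n reverses comultiplication, so the criterion for coalgebra maps does not apply; the
  -- axioms are expanded into the relations `yx`.
  · have hΔ : Coalgebra.comul (R := k) (unop ((univ k s B).y n b)) =
        unop ((univ k s B).tensor.y n b) := lift_y (univ k s B).tensor n b
    have hε : Coalgebra.counit (R := k) (unop ((univ k s B).y n b)) = Coalgebra.counit (R := k) b :=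
      lift_y (AntipodeChain.counit k s B) n b
    have hσ (b) : lift (univ k s B).shift (unop ((univ k s B).y n b)) =
        op ((univ k s B).x (s n) b) := lift_y (univ k s B).shift n b
    have h := ConvInv.iff_sum.1 ((univ k s B).yx n) b
    change unop ((univ k s B).y n b) ∈ _
    constructor
    · rw [LinearMap.convMul_apply, hΔ, hε]
      refine Eq.trans ?_ congr(unop $(h.1))
      simp [AntipodeChain.tensor, ← (Coalgebra.Repr.arbitrary k b).eq, hσ]
    · rw [LinearMap.convMul_apply, hΔ, hε]
      refine Eq.trans ?_ congr(unop $(h.2))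
      simp [AntipodeChain.tensor, ← (Coalgebra.Repr.arbitrary k b).eq, hσ]

/-- The Hopf algebra structure on the universal algebra. -/
abbrev hopfAlgebra : HopfAlgebra k (ChainAlg k s B) :=
  letI : Bialgebra k (ChainAlg k s B) := bialgebra hN
  HopfAlgebra.ofGenerators (lift (univ k s B).shift) (antipodeLocus_eq_top hN)

/-- The inverse is induced by the chain shifted backwards: both composites are algebra endomorphisms
fixing x z, hence identities. -/
theorem bijective_antipode (p : N → N) (hps : ∀ n, p (s n) = n) (hsp : ∀ n, s (p n) = n) :
    letI : HopfAlgebra k (ChainAlg k s B) := hopfAlgebra hN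
    Function.Bijective (HopfAlgebraStruct.antipode k : ChainAlg k s B →ₗ[k] ChainAlg k s B) := by
  let : HopfAlgebra k (ChainAlg k s B) := hopfAlgebra hN
  let σ := lift (univ k s B).shift
  let τ := lift ((univ k s B).unshift p hps hsp)
  have h1 : (AlgHom.opComm σ).comp τ = AlgHom.id k _ := hom_ext hN <| by
    ext b
    have h2 : τ ((univ k s B).x z b) = (univ k s B).y (p z) b := lift_x _ _ _
    have h3 : σ (unop ((univ k s B).y (p z) b)) = op ((univ k s B).x (s (p z)) b) := lift_y _ _ _
    rw [hsp] at h3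
    simp [h2, h3]
  have h2 : (AlgHom.opComm τ).comp σ = AlgHom.id k _ := hom_ext hN <| by
    ext b
    have h2 : σ ((univ k s B).x z b) = (univ k s B).y z b := lift_x _ _ _
    have h3 : τ (unop ((univ k s B).y z b)) = op ((univ k s B).x z b) := lift_y _ _ _
    simp [h2, h3]
  exact Function.bijective_iff_has_inverse.2
    ⟨fun q => unop (τ q), fun q => congr($h2 q), fun q => congr($h1 q)⟩

end Hopf

end ChainAlg

end Chains

/-! ### Free Hopf algebras, with or without bijective antipode -/

section Envelope

variable {k : Type u} [Field k]

/-- The condition of having a bijective antipode, imposed when the flag `b` is set. -/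
def FlagBijective (k : Type u) [Field k] (b : Bool) (H : Type u) [Ring H] [HopfAlgebra k H] :
    Prop :=
  b = true → Function.Bijective (HopfAlgebraStruct.antipode k : H →ₗ[k] H)

/-- The square of the antipode as an algebra map. -/
def antipodeSq (k : Type u) [Field k] (H : Type u) [Ring H] [HopfAlgebra k H] : H →ₐ[k] H :=
  (AlgHom.opComm (HopfAlgebra.antipodeAlgHomOp k H)).comp (HopfAlgebra.antipodeAlgHomOp k H)

/-- Here T n plays the role of S^{2n}. The last clause supplies uniqueness of the factorization and
makes η epic. -/
theorem exists_envelope_of_chain {N : Type} {s : N → N} {z : N}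
    (hN : ∀ p : N → Prop, p z → (∀ n, p n ↔ p (s n)) → ∀ n, p n) (b : Bool)
    (hb : b = true → ∃ p : N → N, (∀ n, p (s n) = n) ∧ ∀ n, s (p n) = n)
    (hT : ∀ (H : Type u) [Ring H] [HopfAlgebra k H], FlagBijective k b H →
      ∃ T : N → H →ₐ[k] H, T z = AlgHom.id k H ∧
        ∀ n h, T (s n) h = T n (HopfAlgebra.antipode k (HopfAlgebra.antipode k h)))
    (B : Type u) [Ring B] [Bialgebra k B] :
    ∃ (Q : Type u) (_ : Ring Q) (_ : HopfAlgebra k Q) (η : B →ₐc[k] Q), FlagBijective k b Q ∧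
      (∀ (H : Type u) [Ring H] [HopfAlgebra k H], FlagBijective k b H → ∀ f : B →ₐc[k] H,
        ∃ g : Q →ₐc[k] H, g.comp η = f) ∧
      ∀ (E : Type u) [Ring E] [Algebra k E] (f g : Q →ₐ[k] E),
        (∀ b, f (η b) = g (η b)) → f = g := by
  let : HopfAlgebra k (ChainAlg k s B) := ChainAlg.hopfAlgebra hN
  refine ⟨ChainAlg k s B, inferInstance, inferInstance,
    BialgHom.ofAlgHom ((ChainAlg.univ k s B).x z) ?_ ?_, ?_, ?_, ?_⟩
  · ext b
    exact ChainAlg.lift_x (AntipodeChain.counit k s B) z b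
  · ext b
    exact (ChainAlg.lift_x (ChainAlg.univ k s B).tensor z b).symm
  · intro h
    obtain ⟨p, hps, hsp⟩ := hb h
    exact ChainAlg.bijective_antipode hN p hps hsp
  · intro H _ _ hH f
    obtain ⟨T, hz, hT⟩ := hT H hH
    let c := AntipodeChain.ofHopf T hT f
    have hc (b) : ChainAlg.lift c ((ChainAlg.univ k s B).x z b) = f b :=
      (ChainAlg.lift_x c z b).trans (by simp [c, AntipodeChain.ofHopf, hz])
    refine ⟨BialgHom.ofAlgHom (ChainAlg.lift c) ?_ ?_, ?_⟩
    · refine ChainAlg.hom_ext hN ?_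
      ext b
      have h2 : Bialgebra.counitAlgHom k (ChainAlg k s B) ((ChainAlg.univ k s B).x z b) =
        Coalgebra.counit b := ChainAlg.lift_x (AntipodeChain.counit k s B) z b
      simp [hc, h2]
    · refine ChainAlg.hom_ext hN ?_
      ext b
      have h2 : Bialgebra.comulAlgHom k (ChainAlg k s B) ((ChainAlg.univ k s B).x z b) =
        (ChainAlg.univ k s B).tensor.x z b := ChainAlg.lift_x (ChainAlg.univ k s B).tensor z b
      have h3 : (ChainAlg.lift c).comp ((ChainAlg.univ k s B).x z) = (f : B →ₐ[k] H) :=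
        AlgHom.ext hc
      have h4 : Algebra.TensorProduct.map (ChainAlg.lift c) (ChainAlg.lift c)
          ((ChainAlg.univ k s B).tensor.x z b) =
          Algebra.TensorProduct.map (f : B →ₐ[k] H) (f : B →ₐ[k] H) (Coalgebra.comul b) := by
        rw [← h3, Algebra.TensorProduct.map_comp]
        rfl
      refine (congrArg _ h2).trans (h4.trans ?_)
      refine Eq.trans ?_ congr(Coalgebra.comul (R := k) $(hc b)).symm
      exact congr($(CoalgHomClass.map_comp_comul f) b)
    · ext b
      exact hc b
  · intro E _ _ f g h
    exact ChainAlg.hom_ext hN (AlgHom.ext h)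

theorem exists_envelope (b : Bool) (B : Type u) [Ring B] [Bialgebra k B] :
    ∃ (Q : Type u) (_ : Ring Q) (_ : HopfAlgebra k Q) (η : B →ₐc[k] Q), FlagBijective k b Q ∧
      (∀ (H : Type u) [Ring H] [HopfAlgebra k H], FlagBijective k b H → ∀ f : B →ₐc[k] H,
        ∃ g : Q →ₐc[k] H, g.comp η = f) ∧
      ∀ (E : Type u) [Ring E] [Algebra k E] (f g : Q →ₐ[k] E),
        (∀ b, f (η b) = g (η b)) → f = g := by
  cases b
  · refine exists_envelope_of_chain (s := Nat.succ) (z := 0)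
      (fun p h0 hs n => Nat.rec h0 (fun n => (hs n).1) n) false (by simp) (fun H _ _ _ => ?_) B
    exact ⟨fun n => antipodeSq k H ^ n, by simp; rfl, fun n h => by
      simp only [Nat.succ_eq_add_one, pow_succ]; rfl⟩
  · refine exists_envelope_of_chain (s := fun n : ℤ => n + 1) (z := 0) (fun p h0 hs n => ?_) true
      (fun _ => ⟨fun n => n - 1, by simp, by simp⟩) (fun H _ _ hH => ?_) B
    · induction n using Int.induction_on with
      | zero => exact h0
      | succ n h => exact (hs _).1 h
      | pred n h => exact (hs _).2 (by simpa using h)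
    · let e := AlgEquiv.ofBijective (antipodeSq k H) ((hH rfl).comp (hH rfl))
      exact ⟨fun n => ((e ^ n : H ≃ₐ[k] H) : H →ₐ[k] H), by ext; simp, fun n h => by
        simp [zpow_add_one]; rfl⟩

end Envelope

/-! ### Coordinates on a Hopf algebra over B -/

section Functionals

variable {k : Type u} [Field k]

theorem TensorProduct.eq_zero_of_separating {V ι : Type*} [AddCommGroup V] [Module k V]
    (φ : ι → V →ₗ[k] k) (hφ : ∀ v, (∀ i, φ i v = 0) → v = 0) (t : V ⊗[k] V)
    (h : ∀ i j, LinearMap.mul' k k (TensorProduct.map (φ i) (φ j) t) = 0) : t = 0 := by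
  let e := Module.Basis.ofVectorSpace k V
  obtain ⟨c, rfl⟩ := TensorProduct.eq_repr_basis_left e t
  -- With t = ∑ eᵢ ⊗ cᵢ, contracting the second factor by φ j leaves ∑ φ j (cᵢ) eᵢ, which every
  -- functional of the family kills; its basis coefficients therefore vanish.
  have hc : ∀ j i, φ j (c i) = 0 := by
    intro j i
    have h0 : (c.sum fun i v => φ j v • e i) = 0 := hφ _ fun i => by
      simpa [Finsupp.sum, mul_comm] using h i j
    have h1 : e.repr (c.sum fun i v => φ j v • e i) i = φ j (c i) := by
      classical
      simp only [Finsupp.sum, map_sum, map_smul, Module.Basis.repr_self, Finsupp.smul_single,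
        smul_eq_mul, mul_one, Finsupp.finsetSum_apply, Finsupp.single_apply]
      by_cases hi : c i = 0 <;> simp [hi]
    rw [← h1, h0]
    simp
  have : c = 0 := Finsupp.ext fun i => hφ _ fun j => hc j i
  simp [this]

/-- The inverse of the antipode if the flag `b` is set, the antipode otherwise. -/
def flagInv (k : Type u) [Field k] (b : Bool) (H : Type u) [Ring H] [HopfAlgebra k H] : H →ₗ[k] H :=
  open Classical in
  if h : b = true ∧ Function.Bijective (HopfAlgebraStruct.antipode k : H →ₗ[k] H) then
    (LinearEquiv.ofBijective _ h.2).symm else HopfAlgebra.antipode k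

variable {b : Bool} {H H' : Type u} [Ring H] [HopfAlgebra k H] [Ring H'] [HopfAlgebra k H']

theorem flagInv_false : flagInv k false H = HopfAlgebra.antipode k := by
  simp [flagInv]

theorem antipode_flagInv (hH : FlagBijective k true H) (h : H) :
    HopfAlgebra.antipode k (flagInv k true H h) = h := by
  have := hH rfl
  simp [flagInv, this]

theorem flagInv_antipode (hH : FlagBijective k true H) (h : H) :
    flagInv k true H (HopfAlgebra.antipode k h) = h :=
  (hH rfl).1 (antipode_flagInv hH _)

theorem map_flagInv (hH : FlagBijective k b H) (hH' : FlagBijective k b H') (p : H →ₐc[k] H')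
    (h : H) : p (flagInv k b H h) = flagInv k b H' (p h) := by
  cases b
  · rw [flagInv_false, flagInv_false, BialgHom.map_antipode]
  · apply (hH' rfl).1
    rw [← BialgHom.map_antipode, antipode_flagInv hH, antipode_flagInv hH']

/-- The antipode, or its inverse where the flag requires it to exist, as selected by `c`. -/
def signedAntipode (k : Type u) [Field k] (b c : Bool) (H : Type u) [Ring H]
    [HopfAlgebra k H] : H →ₗ[k] H :=
  if c then HopfAlgebra.antipode k else flagInv k b H

theorem map_signedAntipode (hH : FlagBijective k b H) (hH' : FlagBijective k b H')
    (p : H →ₐc[k] H') (c : Bool) (h : H) :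
    p (signedAntipode k b c H h) = signedAntipode k b c H' (p h) := by
  cases c
  · exact map_flagInv hH hH' p h
  · exact BialgHom.map_antipode p h

theorem convMul_comp_signedAntipode (hH : FlagBijective k b H) (c : Bool) (f g : H →ₗ[k] k) :
    (toConv f * toConv g).ofConv ∘ₗ signedAntipode k b c H =
      (toConv (g ∘ₗ signedAntipode k b c H) * toConv (f ∘ₗ signedAntipode k b c H)).ofConv := by
  cases c
  · cases b
    · simpa [signedAntipode, flagInv_false] using convMul_comp_antipode f g
    -- The case of S⁻¹ follows from that of S: precompose the functionals with S⁻¹ and evaluate at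
    -- S⁻¹ x.
    · have h := convMul_comp_antipode (g ∘ₗ flagInv k true H) (f ∘ₗ flagInv k true H)
      have e (a : H →ₗ[k] k) : (a ∘ₗ flagInv k true H) ∘ₗ HopfAlgebra.antipode k = a := by
        ext x; simp [flagInv_antipode hH]
      rw [e, e] at h
      ext x
      have := congr($h (flagInv k true H x))
      simpa [antipode_flagInv hH, signedAntipode] using this.symm
  · exact convMul_comp_antipode f g

theorem signedAntipode_mul (hH : FlagBijective k b H) (c : Bool) (x y : H) :
    signedAntipode k b c H (x * y) = signedAntipode k b c H y * signedAntipode k b c H x := by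
  cases c
  · cases b
    · simp [signedAntipode, flagInv_false, HopfAlgebra.antipode_mul_antidistrib]
    · apply (hH rfl).1
      simp [signedAntipode, HopfAlgebra.antipode_mul_antidistrib, antipode_flagInv hH]
  · exact HopfAlgebra.antipode_mul_antidistrib x y

theorem signedAntipode_one (hH : FlagBijective k b H) (c : Bool) :
    signedAntipode k b c H (1 : H) = 1 := by
  cases c
  · cases b
    · simp [signedAntipode, flagInv_false]
    · apply (hH rfl).1
      simp [signedAntipode, antipode_flagInv hH]
  · exact HopfAlgebra.antipode_one

/-- The signed antipode as an algebra map to the opposite algebra. -/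
def signedAntipodeOp (hH : FlagBijective k b H) (c : Bool) : H →ₐ[k] Hᵐᵒᵖ :=
  .ofLinearMap ((opLinearEquiv k).toLinearMap ∘ₗ signedAntipode k b c H)
    (unop_injective (signedAntipode_one hH c))
    (fun x y => unop_injective (signedAntipode_mul hH c x y))

variable (k b H) in
/-- Compositions of signed antipodes. -/
def antipodeWord : List Bool → H →ₗ[k] H
  | [] => LinearMap.id
  | c :: w => antipodeWord w ∘ₗ signedAntipode k b c H

theorem map_antipodeWord (hH : FlagBijective k b H) (hH' : FlagBijective k b H')
    (p : H →ₐc[k] H') (w : List Bool) (h : H) :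
    p (antipodeWord k b H w h) = antipodeWord k b H' w (p h) := by
  induction w generalizing h with
  | nil => rfl
  | cons c w ih => simp [antipodeWord, ih, map_signedAntipode hH hH']

variable {B : Type u} [Ring B] [Bialgebra k B]

variable (k B) in
/-- The free algebra whose dual space receives the coordinates of all Hopf algebras over `B`. -/
abbrev CoordAlg : Type u := FreeAlgebra k (List Bool × Module.Dual k B)

variable (b) in
/-- The action of words in functionals on `B` and antipodes on a Hopf algebra over `B`. -/
def wordFunctional (f : H →ₐc[k] B) : CoordAlg k B →ₐ[k] WithConv (H →ₗ[k] k) :=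
  FreeAlgebra.lift k fun p => toConv (p.2 ∘ₗ (f : H →ₗ[k] B) ∘ₗ antipodeWord k b H p.1)

variable (b) in
/-- The coordinates of an element of a Hopf algebra over `B`. -/
def coord (f : H →ₐc[k] B) : H →ₗ[k] (CoordAlg k B → k) :=
  LinearMap.pi fun w => (wordFunctional b f w).ofConv

theorem coord_apply (f : H →ₐc[k] B) (x : H) (w : CoordAlg k B) :
    coord b f x w = wordFunctional b f w x := rfl

/-- Bialgebra maps commute with S, with S⁻¹ where required, and with convolution, so they preserve
every word. -/
theorem coord_natural (hH : FlagBijective k b H) (hH' : FlagBijective k b H') (p : H →ₐc[k] H')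
    (f : H →ₐc[k] B) (f' : H' →ₐc[k] B) (hp : f'.comp p = f) (h : H) :
    coord b f' (p h) = coord b f h := by
  subst hp
  have key (w : CoordAlg k B) : (wordFunctional b f' w).ofConv ∘ₗ (p : H →ₗc[k] H').toLinearMap =
      (wordFunctional b (f'.comp p) w).ofConv := by
    induction w using FreeAlgebra.induction with
    | grade0 r => ext x; simp
    | grade1 x =>
      ext h
      simp [wordFunctional, map_antipodeWord hH hH']
    | mul v w hv hw =>
      rw [map_mul, map_mul, LinearMap.convMul_comp_coalgHom_distrib, hv, hw]
    | add v w hv hw => rw [map_add, map_add, ofConv_add, ofConv_add, LinearMap.add_comp, hv, hw]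
  exact funext fun w => congr($(key w) h)

/-- Precomposition reverses products of words and lengthens the antipode list of each letter, so
equality of coordinates survives signed antipodes. -/
theorem exists_wordFunctional_comp (hH : FlagBijective k b H) (f : H →ₐc[k] B) (c : Bool)
    (w : CoordAlg k B) : ∃ w' : CoordAlg k B,
      (wordFunctional b f w).ofConv ∘ₗ signedAntipode k b c H = (wordFunctional b f w').ofConv := by
  have hε (h : H) : Coalgebra.counit (R := k) (signedAntipode k b c H h) = Coalgebra.counit h := by
    cases c
    · cases b
      · simp [signedAntipode, flagInv_false]
      · rw [← HopfAlgebra.counit_antipode (R := k)]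
        simp [signedAntipode, antipode_flagInv hH]
    · exact HopfAlgebra.counit_antipode h
  induction w using FreeAlgebra.induction with
  | grade0 r => exact ⟨algebraMap k _ r, by ext x; simp [hε]⟩
  | grade1 x =>
    exact ⟨FreeAlgebra.ι k (c :: x.1, x.2), by ext h; simp [wordFunctional, antipodeWord]⟩
  | mul v w hv hw =>
    obtain ⟨v', hv⟩ := hv
    obtain ⟨w', hw⟩ := hw
    refine ⟨w' * v', ?_⟩
    rw [map_mul, map_mul]
    refine (convMul_comp_signedAntipode hH c (wordFunctional b f v).ofConv
      (wordFunctional b f w).ofConv).trans ?_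
    rw [hv, hw]
  | add v w hv hw =>
    obtain ⟨v', hv⟩ := hv
    obtain ⟨w', hw⟩ := hw
    exact ⟨v' + w', by rw [map_add, map_add, ofConv_add, ofConv_add, LinearMap.add_comp, hv, hw]⟩

theorem coord_signedAntipode (hH : FlagBijective k b H) (f : H →ₐc[k] B) (c : Bool) {x y : H}
    (h : coord b f x = coord b f y) :
    coord b f (signedAntipode k b c H x) = coord b f (signedAntipode k b c H y) := by
  funext w
  obtain ⟨w', hw⟩ := exists_wordFunctional_comp hH f c w
  exact (congr($hw x).trans (congrFun h w')).trans congr($hw y).symm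

theorem counit_eq_of_coord_eq (f : H →ₐc[k] B) {x y : H} (h : coord b f x = coord b f y) :
    Coalgebra.counit (R := k) x = Coalgebra.counit y := by
  simpa [coord_apply] using congrFun h 1

theorem map_eq_of_coord_eq (f : H →ₐc[k] B) {x y : H} (h : coord b f x = coord b f y) :
    f x = f y := by
  rw [← sub_eq_zero, ← Module.forall_dual_apply_eq_zero_iff k]
  intro g
  have := congrFun h (FreeAlgebra.ι k ([], g))
  simp only [coord_apply, wordFunctional, FreeAlgebra.lift_ι_apply] at this
  rw [map_sub, sub_eq_zero]
  exact this

/-- The kernel K of the coordinates is a coideal: word functionals separate points of H/K, and v ⊗ w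
applied to a comultiplication is the product word v * w, again a coordinate. -/
theorem map_comul_eq_of_coord_eq (f : H →ₐc[k] B) {Q : Type*} [AddCommGroup Q] [Module k Q]
    (π : H →ₗ[k] Q) (hπ : ∀ x y, coord b f x = coord b f y → π x = π y) {x y : H}
    (h : coord b f x = coord b f y) :
    TensorProduct.map π π (Coalgebra.comul x) = TensorProduct.map π π (Coalgebra.comul y) := by
  let K := LinearMap.ker (coord b f)
  have hK : K ≤ LinearMap.ker π := fun z hz => by
    rw [LinearMap.mem_ker] at hz ⊢
    rw [hπ z 0 (by simp [hz]), map_zero]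
  have hw (w : CoordAlg k B) : K ≤ LinearMap.ker (wordFunctional b f w).ofConv := fun z hz =>
    congrFun (LinearMap.mem_ker.1 hz) w
  have e : π = K.liftQ π hK ∘ₗ K.mkQ := (Submodule.liftQ_mkQ _ _ _).symm
  have hz : x - y ∈ K := by simp [K, h]
  have key : TensorProduct.map K.mkQ K.mkQ (Coalgebra.comul (R := k) (x - y)) = 0 := by
    refine TensorProduct.eq_zero_of_separating (fun w => K.liftQ _ (hw w)) (fun v hv => ?_) _
      fun v w => ?_
    · obtain ⟨z, rfl⟩ := K.mkQ_surjective v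
      rw [Submodule.mkQ_apply, Submodule.Quotient.mk_eq_zero]
      exact funext fun w => hv w
    · have : wordFunctional b f (v * w) (x - y) = 0 := congrFun (LinearMap.mem_ker.1 hz) (v * w)
      rw [map_mul, LinearMap.convMul_apply] at this
      rw [← LinearMap.comp_apply (TensorProduct.map _ _), ← TensorProduct.map_comp,
        Submodule.liftQ_mkQ, Submodule.liftQ_mkQ]
      exact this
  rw [e, TensorProduct.map_comp, ← sub_eq_zero, ← map_sub, ← map_sub, LinearMap.comp_apply, key,
    map_zero]

end Functionals

/-! ### The reduced quotient -/

section Reduced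

variable {k : Type u} [Field k] {b : Bool} {H H' : Type u} [Ring H] [HopfAlgebra k H] [Ring H']
  [HopfAlgebra k H'] {B : Type u} [Ring B] [Bialgebra k B]

theorem bijective_antipode_of_bijective (p : H →ₐc[k] H') (hp : Function.Bijective p)
    (hH : Function.Bijective (HopfAlgebraStruct.antipode k : H →ₗ[k] H)) :
    Function.Bijective (HopfAlgebraStruct.antipode k : H' →ₗ[k] H') := by
  have h : (HopfAlgebra.antipode k : H' →ₗ[k] H') ∘ p = p ∘ (HopfAlgebra.antipode k : H →ₗ[k] H) :=
    funext fun x => (BialgHom.map_antipode p x).symm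
  rw [← hp.of_comp_iff, h]
  exact hp.comp hH

theorem antipodeLocus_eq_top_of_surjective {Q : Type u} [Ring Q] [Bialgebra k Q] (p : H →ₐc[k] Q)
    (hp : Function.Surjective p) (σ : Q →ₐ[k] Qᵐᵒᵖ)
    (hσ : ∀ h, σ (p h) = op (p (HopfAlgebra.antipode k h))) : antipodeLocus σ = ⊤ := by
  refine top_le_iff.1 fun q _ => ?_
  obtain ⟨h, rfl⟩ := hp q
  refine mem_antipodeLocus_of_convInv (p : H →ₗc[k] Q) ?_ h
  convert! (convInv_antipode (k := k) H).algHom_comp (p : H →ₐ[k] Q) using 1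
  ext x
  exact congr(unop $(hσ x))

/-- The quotient of a Hopf algebra over `B` by the equality of coordinates. -/
def Reduced (b : Bool) (f : H →ₐc[k] B) : Type u :=
  RingQuot fun x y => coord b f x = coord b f y

namespace Reduced

variable (f : H →ₐc[k] B)

instance : Ring (Reduced b f) := inferInstanceAs (Ring (RingQuot _))
instance : Algebra k (Reduced b f) := inferInstanceAs (Algebra k (RingQuot _))

variable (b) in
/-- The quotient map. -/
def mk : H →ₐ[k] Reduced b f := RingQuot.mkAlgHom k _

theorem mk_surjective : Function.Surjective (mk b f) := RingQuot.mkAlgHom_surjective k _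

theorem mk_eq {x y : H} (h : coord b f x = coord b f y) : mk b f x = mk b f y :=
  RingQuot.mkAlgHom_rel k h

variable {f}

/-- The universal property of the quotient. -/
def lift {E : Type*} [Ring E] [Algebra k E] (g : H →ₐ[k] E)
    (hg : ∀ ⦃x y⦄, coord b f x = coord b f y → g x = g y) : Reduced b f →ₐ[k] E :=
  RingQuot.liftAlgHom k ⟨g, hg⟩

@[simp]
theorem lift_mk {E : Type*} [Ring E] [Algebra k E] (g : H →ₐ[k] E)
    (hg : ∀ ⦃x y⦄, coord b f x = coord b f y → g x = g y) (x : H) :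
    lift g hg (mk b f x) = g x :=
  RingQuot.liftAlgHom_mkAlgHom_apply k _ _ _

instance : Bialgebra k (Reduced b f) :=
  Bialgebra.ofJointlyEpi (A := fun _ : Unit => H) (fun _ => mk b f)
    (fun _ _ _ _ _ h => AlgHom.ext fun q => by
      obtain ⟨x, rfl⟩ := mk_surjective f q
      exact congr($(h ()) x))
    (lift ((Algebra.TensorProduct.map (mk b f) (mk b f)).comp (Bialgebra.comulAlgHom k H))
      fun _ _ h => map_comul_eq_of_coord_eq f (mk b f).toLinearMap (fun _ _ => mk_eq f) h)
    (lift (Bialgebra.counitAlgHom k H) fun _ _ h => counit_eq_of_coord_eq f h)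
    (fun _ => AlgHom.ext fun _ => lift_mk _ _ _) (fun _ => AlgHom.ext fun _ => lift_mk _ _ _)

variable (b f) in
/-- The quotient map as a bialgebra map. -/
def mkBialg : H →ₐc[k] Reduced b f :=
  BialgHom.ofAlgHom (mk b f) (AlgHom.ext fun _ => lift_mk _ _ _)
    (AlgHom.ext fun _ => (lift_mk _ _ _).symm)

/-- The structure map of the quotient. -/
def desc : Reduced b f →ₐc[k] B :=
  BialgHom.ofAlgHom (lift (f : H →ₐ[k] B) fun _ _ h => map_eq_of_coord_eq f h)
    (AlgHom.ext fun q => by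
      obtain ⟨x, rfl⟩ := mk_surjective f q
      have h : Coalgebra.counit (R := k) (mk b f x) = Coalgebra.counit x :=
        congr($(BialgHom.counitAlgHom_comp (mkBialg b f)) x)
      exact (congrArg (Coalgebra.counit (R := k)) (lift_mk _ _ x)).trans
        (congr($(BialgHom.counitAlgHom_comp f) x).trans h.symm))
    (AlgHom.ext fun q => by
      obtain ⟨x, rfl⟩ := mk_surjective f q
      have h : Coalgebra.comul (R := k) (mk b f x) =
        Algebra.TensorProduct.map (mk b f) (mk b f) (Coalgebra.comul x) := lift_mk _ _ _
      have h2 : (lift (f : H →ₐ[k] B) fun _ _ h => map_eq_of_coord_eq f h).comp (mk b f) =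
        (f : H →ₐ[k] B) := AlgHom.ext fun _ => lift_mk _ _ _
      refine Eq.trans ?_ (congrArg (Coalgebra.comul (R := k)) (lift_mk _ _ x)).symm
      simp only [AlgHom.comp_apply, Bialgebra.comulAlgHom_apply, h]
      rw [← AlgHom.comp_apply, ← Algebra.TensorProduct.map_comp, h2]
      exact congr($(CoalgHomClass.map_comp_comul f) x))

theorem desc_comp_mkBialg : (desc : Reduced b f →ₐc[k] B).comp (mkBialg b f) = f :=
  BialgHom.ext fun _ => lift_mk _ _ _

/-- The antihomomorphism induced by a signed antipode. -/
def signedAntipodeOp (hH : FlagBijective k b H) (c : Bool) :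
    Reduced b f →ₐ[k] (Reduced b f)ᵐᵒᵖ :=
  lift ((AlgHom.op (mk b f)).comp (_root_.signedAntipodeOp hH c))
    fun _ _ h => congrArg op (mk_eq f (coord_signedAntipode hH f c h))

theorem signedAntipodeOp_mk (hH : FlagBijective k b H) (c : Bool) (x : H) :
    signedAntipodeOp hH c (mk b f x) = op (mk b f (signedAntipode k b c H x)) :=
  lift_mk _ _ _

/-- The Hopf algebra structure on the quotient. -/
abbrev hopfAlgebra (hH : FlagBijective k b H) : HopfAlgebra k (Reduced b f) :=
  HopfAlgebra.ofGenerators (signedAntipodeOp hH true)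
    (antipodeLocus_eq_top_of_surjective (mkBialg b f) (mk_surjective f) _
      (signedAntipodeOp_mk hH true))

theorem flagBijective (hH : FlagBijective k b H) :
    letI : HopfAlgebra k (Reduced b f) := hopfAlgebra hH
    FlagBijective k b (Reduced b f) := by
  rintro rfl
  refine Function.bijective_iff_has_inverse.2
    ⟨fun q => unop (signedAntipodeOp hH false q), fun q => ?_, fun q => ?_⟩ <;>
  obtain ⟨x, rfl⟩ := mk_surjective f q
  · change unop (signedAntipodeOp hH false (unop (signedAntipodeOp hH true (mk true f x)))) = _
    simp [signedAntipodeOp_mk, signedAntipode, flagInv_antipode hH]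
  · change unop (signedAntipodeOp hH true (unop (signedAntipodeOp hH false (mk true f x)))) = _
    simp [signedAntipodeOp_mk, signedAntipode, antipode_flagInv hH]

/-- By naturality the quotient map preserves coordinates, so dividing by the generated ideal
identifies nothing further. -/
theorem coord_desc_injective (hH : FlagBijective k b H) :
    letI : HopfAlgebra k (Reduced b f) := hopfAlgebra hH
    Function.Injective (coord b (desc : Reduced b f →ₐc[k] B)) := by
  let : HopfAlgebra k (Reduced b f) := hopfAlgebra hH
  intro q q' h
  obtain ⟨x, rfl⟩ := mk_surjective f q
  obtain ⟨y, rfl⟩ := mk_surjective f q'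
  have key (x) : coord b (desc : Reduced b f →ₐc[k] B) (mk b f x) = coord b f x :=
    coord_natural hH (flagBijective hH) (mkBialg b f) f desc desc_comp_mkBialg x
  rw [key, key] at h
  exact mk_eq f h

end Reduced

theorem exists_reduced (hH : FlagBijective k b H) (f : H →ₐc[k] B) :
    ∃ (Q : Type u) (_ : Ring Q) (_ : HopfAlgebra k Q) (g : Q →ₐc[k] B) (π : H →ₐc[k] Q),
      FlagBijective k b Q ∧ g.comp π = f ∧ Function.Injective (coord b g) := by
  let : HopfAlgebra k (Reduced b f) := Reduced.hopfAlgebra hH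
  exact ⟨Reduced b f, inferInstance, inferInstance, Reduced.desc, Reduced.mkBialg b f,
    Reduced.flagBijective hH, Reduced.desc_comp_mkBialg, Reduced.coord_desc_injective hH⟩

end Reduced

/-! ### Coproducts of Hopf algebras -/

section Coproduct

variable {k : Type u} [Field k] {b : Bool} {I : Type u} (A : I → Type u) [∀ i, Ring (A i)]
  [∀ i, HopfAlgebra k (A i)]

variable (k) in
/-- The coproduct of a family of algebras. -/
abbrev CoprodAlg : Type u :=
  UnivAlg k (Σ i, A i) fun E _ _ v => ∃ g : ∀ i, A i →ₐ[k] E, v = fun p => g p.1 p.2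

namespace CoprodAlg

variable {A}

/-- Equality in the coproduct holds when it holds for all families of algebra maps. -/
theorem mk_eq {x y : FreeAlgebra k (Σ i, A i)}
    (h : ∀ (E : Type u) [Ring E] [Algebra k E] (g : ∀ i, A i →ₐ[k] E),
      FreeAlgebra.lift k (fun p : Σ i, A i => g p.1 p.2) x =
        FreeAlgebra.lift k (fun p : Σ i, A i => g p.1 p.2) y) :
    (UnivAlg.mk k _ _ x : CoprodAlg k A) = UnivAlg.mk k _ _ y := by
  refine UnivAlg.mk_eq fun E _ _ v hv => ?_
  obtain ⟨g, rfl⟩ := hv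
  exact h E g

variable (k) in
/-- The free variables. -/
abbrev free (i : I) (a : A i) : FreeAlgebra k (Σ i, A i) := FreeAlgebra.ι k ⟨i, a⟩

/-- The coproduct injections. -/
def incl (i : I) : A i →ₐ[k] CoprodAlg k A where
  toFun a := UnivAlg.gen _ _ _ ⟨i, a⟩
  map_one' := (mk_eq (x := free k i 1) (y := 1) (by simp)).trans (by simp)
  map_mul' a b := (mk_eq (x := free k i (a * b)) (y := free k i a * free k i b)
    (by simp)).trans (map_mul _ _ _)
  map_zero' := (mk_eq (x := free k i 0) (y := 0) (by simp)).trans (by simp)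
  map_add' a b := (mk_eq (x := free k i (a + b)) (y := free k i a + free k i b)
    (by simp)).trans (map_add _ _ _)
  commutes' r := (mk_eq (x := free k i (algebraMap k (A i) r)) (y := algebraMap k _ r)
    (by simp)).trans (by simp)

variable {E : Type u} [Ring E] [Algebra k E]

/-- The universal property of the coproduct. -/
def lift (g : ∀ i, A i →ₐ[k] E) : CoprodAlg k A →ₐ[k] E := UnivAlg.lift ⟨g, rfl⟩

@[simp]
theorem lift_incl (g : ∀ i, A i →ₐ[k] E) (i : I) (a : A i) : lift g (incl i a) = g i a :=
  UnivAlg.lift_gen _ _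

theorem lift_comp_incl (g : ∀ i, A i →ₐ[k] E) (i : I) : (lift g).comp (incl i) = g i :=
  AlgHom.ext fun _ => lift_incl _ _ _

theorem jointlyEpi_incl : JointlyEpi fun i => (incl i : A i →ₐ[k] CoprodAlg k A) :=
  fun _ _ _ _ _ h => UnivAlg.hom_ext fun x => congr($(h x.1) x.2)

instance : Bialgebra k (CoprodAlg k A) :=
  Bialgebra.ofJointlyEpi _ jointlyEpi_incl
    (lift fun i => (Algebra.TensorProduct.map (incl i) (incl i)).comp
      (Bialgebra.comulAlgHom k (A i)))
    (lift fun i => Bialgebra.counitAlgHom k (A i)) (lift_comp_incl _) (lift_comp_incl _)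

/-- The coproduct injections as bialgebra maps. -/
def inclBialg (i : I) : A i →ₐc[k] CoprodAlg k A :=
  BialgHom.ofAlgHom (incl i) (lift_comp_incl _ i)
    (lift_comp_incl (fun i => (Algebra.TensorProduct.map (incl i) (incl i)).comp
      (Bialgebra.comulAlgHom k (A i))) i).symm

/-- The universal property of the coproduct for bialgebra maps. -/
theorem exists_lift {B : Type u} [Ring B] [Bialgebra k B] (g : ∀ i, A i →ₐc[k] B) :
    ∃ f : CoprodAlg k A →ₐc[k] B, ∀ i, f.comp (inclBialg i) = g i := by
  let f := lift fun i => (g i : A i →ₐ[k] B)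
  have hf (i) : f.comp (incl i) = g i := lift_comp_incl _ i
  refine ⟨BialgHom.ofAlgHom f (jointlyEpi_incl _ _ fun i => ?_) (jointlyEpi_incl _ _ fun i => ?_),
    fun i => BialgHom.ext fun a => congr($(hf i) a)⟩
  · rw [AlgHom.comp_assoc, hf, BialgHom.counitAlgHom_comp]
    exact (lift_comp_incl (fun i => Bialgebra.counitAlgHom k (A i)) i).symm
  · rw [AlgHom.comp_assoc, AlgHom.comp_assoc, hf, ← BialgHom.map_comp_comulAlgHom]
    refine (congrArg (AlgHom.comp _) (lift_comp_incl
      (fun i => (Algebra.TensorProduct.map (incl i) (incl i)).comp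
        (Bialgebra.comulAlgHom k (A i))) i)).trans ?_
    rw [← AlgHom.comp_assoc, ← Algebra.TensorProduct.map_comp, hf]

/-- The antihomomorphism induced by signed antipodes. -/
def signedAntipodeOp (hA : ∀ i, FlagBijective k b (A i)) (c : Bool) :
    CoprodAlg k A →ₐ[k] (CoprodAlg k A)ᵐᵒᵖ :=
  lift fun i => (AlgHom.op (incl i)).comp (_root_.signedAntipodeOp (hA i) c)

theorem signedAntipodeOp_incl (hA : ∀ i, FlagBijective k b (A i)) (c : Bool) (i : I) (a : A i) :
    signedAntipodeOp hA c (incl i a) = op (incl i (signedAntipode k b c (A i) a)) :=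
  lift_incl _ _ _

theorem antipodeLocus_eq_top (hA : ∀ i, FlagBijective k b (A i)) :
    antipodeLocus (signedAntipodeOp hA true) = ⊤ := by
  refine top_le_iff.1 fun q _ => UnivAlg.mem_of_gen _ (fun x => ?_) q
  refine mem_antipodeLocus_of_convInv 
    ((inclBialg x.1 : A x.1 →ₐc[k] CoprodAlg k A) : A x.1 →ₗc[k] CoprodAlg k A) ?_ x.2
  convert! (convInv_antipode (k := k) (A x.1)).algHom_comp (incl x.1 : A x.1 →ₐ[k] CoprodAlg k A)
    using 1
  ext a
  exact congr(unop $(signedAntipodeOp_incl hA true x.1 a))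

/-- The Hopf algebra structure on the coproduct. -/
abbrev hopfAlgebra (hA : ∀ i, FlagBijective k b (A i)) : HopfAlgebra k (CoprodAlg k A) :=
  HopfAlgebra.ofGenerators (signedAntipodeOp hA true) (antipodeLocus_eq_top hA)

theorem flagBijective (hA : ∀ i, FlagBijective k b (A i)) :
    letI : HopfAlgebra k (CoprodAlg k A) := hopfAlgebra hA
    FlagBijective k b (CoprodAlg k A) := by
  rintro rfl
  let σ := signedAntipodeOp hA true
  let τ := signedAntipodeOp hA false
  have h1 : (AlgHom.opComm σ).comp τ = AlgHom.id k _ := jointlyEpi_incl _ _ fun i => by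
    ext a
    simp [σ, τ, signedAntipodeOp_incl, signedAntipode, antipode_flagInv (hA i)]
  have h2 : (AlgHom.opComm τ).comp σ = AlgHom.id k _ := jointlyEpi_incl _ _ fun i => by
    ext a
    simp [σ, τ, signedAntipodeOp_incl, signedAntipode, flagInv_antipode (hA i)]
  exact Function.bijective_iff_has_inverse.2
    ⟨fun q => unop (τ q), fun q => congr($h2 q), fun q => congr($h1 q)⟩

end CoprodAlg

end Coproduct

/-! ### Cofree Hopf algebras, with or without bijective antipode -/

section Cofree

variable {k : Type u} [Field k] {b : Bool}

theorem exists_transport {H : Type u} [Ring H] [HopfAlgebra k H] {X : Type u} (e : H ≃ X) :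
    ∃ (_ : Ring X) (_ : HopfAlgebra k X) (p : H ≃ₐc[k] X), ∀ h, p h = e h := by
  let _ : Ring X := e.symm.ring
  let _ : Algebra k X := e.symm.algebra k
  let p : H ≃ₐ[k] X := (e.symm.algEquiv k).symm
  let _ : Bialgebra k X := Bialgebra.ofJointlyEpi (A := fun _ : Unit => H) (fun _ => p)
    (fun _ _ _ _ _ h => AlgHom.ext fun q => by simpa using congr($(h ()) (p.symm q)))
    ((Algebra.TensorProduct.map (p : H →ₐ[k] X) (p : H →ₐ[k] X)).comp
      ((Bialgebra.comulAlgHom k H).comp p.symm))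
    ((Bialgebra.counitAlgHom k H).comp p.symm)
    (fun _ => by ext; simp) (fun _ => by ext; simp)
  let p' : H →ₐc[k] X := BialgHom.ofAlgHom (p : H →ₐ[k] X)
    (AlgHom.ext fun x => congrArg (Coalgebra.counit (R := k)) (p.symm_apply_apply x))
    (AlgHom.ext fun x => congrArg (fun y => Algebra.TensorProduct.map (p : H →ₐ[k] X)
      (p : H →ₐ[k] X) (Coalgebra.comul (R := k) y)) (p.symm_apply_apply x).symm)
  let σ : X →ₐ[k] Xᵐᵒᵖ := (AlgHom.op (p : H →ₐ[k] X)).comp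
    ((HopfAlgebra.antipodeAlgHomOp k H).comp p.symm)
  let _ : HopfAlgebra k X := HopfAlgebra.ofGenerators σ
    (antipodeLocus_eq_top_of_surjective p' p.surjective σ fun h => by
      refine congrArg (fun y => op (p (HopfAlgebra.antipode k y))) (p.symm_apply_apply h))
  exact ⟨inferInstance, inferInstance, BialgEquiv.ofBijective p' p.bijective, fun h => rfl⟩

/-- Hopf algebras over `B` whose elements are coordinate vectors. -/
structure CoordObject (k : Type u) [Field k] (b : Bool) (B : Type u) [Ring B] [Bialgebra k B] :
    Type u where
  /-- The underlying set. -/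
  carrier : Set (CoordAlg k B → k)
  [ring : Ring carrier]
  [hopf : HopfAlgebra k carrier]
  flag : FlagBijective k b carrier
  /-- The structure map. -/
  hom : carrier →ₐc[k] B

attribute [instance] CoordObject.ring CoordObject.hopf

variable {B : Type u} [Ring B] [Bialgebra k B]

/-- This bounds the size: a reduced object is carried over to the range of its coordinates, so
`CoordObject`, a type in universe u, represents all of them. -/
theorem exists_coordObject {H : Type u} [Ring H] [HopfAlgebra k H] (hH : FlagBijective k b H)
    (f : H →ₐc[k] B) (hf : Function.Injective (coord b f)) :
    ∃ (X : CoordObject k b B) (p : H →ₐc[k] X.carrier), X.hom.comp p = f := by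
  obtain ⟨_, _, p, -⟩ := exists_transport (k := k) (Equiv.ofInjective _ hf)
  exact ⟨⟨Set.range (coord b f), fun h => bijective_antipode_of_bijective
    (p : H →ₐc[k] Set.range (coord b f)) p.bijective (hH h),
    f.comp (p.symm : Set.range (coord b f) →ₐc[k] H)⟩, (p : H →ₐc[k] Set.range (coord b f)),
    BialgHom.ext fun x => congrArg f (p.symm_apply_apply x)⟩

variable (b B) in
/-- Every bialgebra has a universal map from a Hopf algebra, and from a Hopf algebra with
bijective antipode. -/
theorem exists_coenvelope :
    ∃ (Q : Type u) (_ : Ring Q) (_ : HopfAlgebra k Q) (ε : Q →ₐc[k] B), FlagBijective k b Q ∧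
      ∀ (H : Type u) [Ring H] [HopfAlgebra k H], FlagBijective k b H → ∀ f : H →ₐc[k] B,
        ∃! g : H →ₐc[k] Q, ε.comp g = f := by
  have hA (X : CoordObject k b B) : FlagBijective k b X.carrier := X.flag
  let A : CoordObject k b B → Type u := fun X => X.carrier
  let _ : HopfAlgebra k (CoprodAlg k A) := CoprodAlg.hopfAlgebra hA
  obtain ⟨φ, hφ⟩ := CoprodAlg.exists_lift (A := A) CoordObject.hom
  -- The coproduct is only weakly terminal over B; reducing it forces uniqueness.
  obtain ⟨Q, _, _, ε, π, hQ, hπ, hε⟩ := exists_reduced (CoprodAlg.flagBijective hA) φ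
  refine ⟨Q, _, _, ε, hQ, fun H _ _ hH f => ?_⟩
  obtain ⟨L, _, _, f', ρ, hL, hρ, hf'⟩ := exists_reduced hH f
  obtain ⟨X, p, hp⟩ := exists_coordObject hL f' hf'
  refine existsUnique_of_exists_of_unique
    ⟨π.comp ((CoprodAlg.inclBialg X).comp (p.comp ρ)), ?_⟩ fun g g' hg hg' => ?_
  · ext x
    have h1 := congr($hπ (CoprodAlg.inclBialg X (p (ρ x))))
    have h2 := congr($(hφ X) (p (ρ x)))
    have h3 := congr($hp (ρ x))
    have h4 := congr($hρ x)
    exact h1.trans (h2.trans (h3.trans h4))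
  · ext x
    exact hε ((coord_natural hH hQ g f ε hg x).trans (coord_natural hH hQ g' f ε hg' x).symm)

end Cofree

/-! ### Adjoints from universal arrows, epic units and monic counits -/

section Adjunctions

open Limits

universe v₁ v₂ u₁ u₂

variable {C : Type u₁} [Category.{v₁} C] {D : Type u₂} [Category.{v₂} D]

theorem CategoryTheory.Functor.isRightAdjoint_of_exists_universal (G : D ⥤ C)
    (h : ∀ A : C, ∃ (Q : D) (η : A ⟶ G.obj Q), ∀ (X : D) (f : A ⟶ G.obj X),
      ∃! g : Q ⟶ X, η ≫ G.map g = f) : G.IsRightAdjoint := by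
  rw [isRightAdjoint_iff_hasInitial_structuredArrow]
  intro A
  obtain ⟨Q, η, hη⟩ := h A
  refine IsInitial.hasInitial (X := StructuredArrow.mk η) (.ofUniqueHom
    (fun X => StructuredArrow.homMk (hη X.right X.hom).choose (hη X.right X.hom).choose_spec.1)
    fun X m => ?_)
  ext
  exact (hη X.right X.hom).choose_spec.2 _ (StructuredArrow.w m)

theorem CategoryTheory.Functor.isLeftAdjoint_of_exists_universal (G : D ⥤ C)
    (h : ∀ A : C, ∃ (Q : D) (ε : G.obj Q ⟶ A), ∀ (X : D) (f : G.obj X ⟶ A),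
      ∃! g : X ⟶ Q, G.map g ≫ ε = f) : G.IsLeftAdjoint := by
  rw [isLeftAdjoint_iff_hasTerminal_costructuredArrow]
  intro A
  obtain ⟨Q, ε, hε⟩ := h A
  refine IsTerminal.hasTerminal (X := CostructuredArrow.mk ε) (.ofUniqueHom
    (fun X => CostructuredArrow.homMk (hε X.left X.hom).choose (hε X.left X.hom).choose_spec.1)
    fun X m => ?_)
  ext
  exact (hε X.left X.hom).choose_spec.2 _ (CostructuredArrow.w m)

/-- The comparison g has a section by the universal property of the unit, so the unit is an
epimorphism followed by a split epimorphism. This covers an arbitrary choice of adjoint. -/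
theorem CategoryTheory.Adjunction.epi_unit_app_of_epi {G : D ⥤ C} {L : C ⥤ D} (adj : L ⊣ G)
    {A : C} {Q : D} (η : A ⟶ G.obj Q) [Epi η] (g : Q ⟶ L.obj A)
    (hg : η ≫ G.map g = adj.unit.app A) : Epi (adj.unit.app A) := by
  obtain ⟨g', hg'⟩ : ∃ g' : L.obj A ⟶ Q, adj.unit.app A ≫ G.map g' = η :=
    ⟨(adj.homEquiv A Q).symm η, (adj.homEquiv_unit ..).symm.trans (Equiv.apply_symm_apply _ _)⟩
  have h : g' ≫ g = 𝟙 _ := (adj.homEquiv _ _).injective <| by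
    rw [adj.homEquiv_unit, adj.homEquiv_unit, G.map_comp, reassoc_of% hg', hg]
    simp
  have : IsSplitEpi (G.map g) := ⟨⟨⟨G.map g', by rw [← G.map_comp, h, G.map_id]⟩⟩⟩
  rw [← hg]
  exact epi_comp _ _

/-- Maps from X into the image of G factor through the unit at X; cancelling that epimorphism
reduces to maps coming from D, on which composition with the counit is injective by adjunction. -/
theorem CategoryTheory.Adjunction.mono_counit_app_of_epi_unit {G : D ⥤ C} {L R : C ⥤ D}
    (adj : L ⊣ G) (adj' : G ⊣ R) (h : ∀ A, Epi (adj.unit.app A)) (A : C) :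
    Mono (adj'.counit.app A) := by
  refine ⟨fun {X} f g hfg => ?_⟩
  have key (p : X ⟶ G.obj (R.obj A)) : ∃ p', adj.unit.app X ≫ G.map p' = p :=
    ⟨(adj.homEquiv _ _).symm p, (adj.homEquiv_unit ..).symm.trans (Equiv.apply_symm_apply _ _)⟩
  obtain ⟨f, rfl⟩ := key f
  obtain ⟨g, rfl⟩ := key g
  have := h X
  have h1 : G.map f ≫ adj'.counit.app A = G.map g ≫ adj'.counit.app A := by
    rw [← cancel_epi (adj.unit.app X)]
    simpa using hfg
  have h2 : f = g := (adj'.homEquiv _ _).symm.injective <| by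
    rw [adj'.homEquiv_counit, adj'.homEquiv_counit, h1]
  rw [h2]

end Adjunctions

/-! ### Passage to the categories of bialgebras and Hopf algebras -/

section Transfer

variable {k : Type u} [Field k]

theorem isHopf_of_bialgEquiv {B H : Type u} [Ring B] [Bialgebra k B] [Ring H] [HopfAlgebra k H]
    (e : B ≃ₐc[k] H) : IsHopf k B := by
  have h := ((convInv_antipode (k := k) H).comp_coalgHom (e : B →ₗc[k] H)).algHom_comp
    (e.symm : H →ₐ[k] B)
  have h1 : (e.symm : H →ₐ[k] B).toLinearMap ∘ₗ LinearMap.id ∘ₗ (e : B →ₗc[k] H).toLinearMap =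
      LinearMap.id := LinearMap.ext fun b => e.symm_apply_apply b
  rw [h1] at h
  exact ⟨_, congrArg ofConv h.2, congrArg ofConv h.1⟩

variable (k) in
theorem flagBijective_false (H : Type u) [Ring H] [HopfAlgebra k H] : FlagBijective k false H :=
  fun h => absurd h (by simp)

theorem exists_hopf_envelope (B : BialgCat.{u} k) :
    ∃ (Q : HopfAlgCat.{u} k) (η : B ⟶ (hopfInclusion k).obj Q), Epi η ∧
      ∀ (X : HopfAlgCat.{u} k) (f : B ⟶ (hopfInclusion k).obj X),
        ∃! g : Q ⟶ X, η ≫ (hopfInclusion k).map g = f := by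
  obtain ⟨Q, _, _, η, -, h, hη⟩ := exists_envelope (k := k) false B
  have hepi {X : BialgCat.{u} k} (g g' : BialgCat.of k Q ⟶ X)
      (hg : BialgCat.Hom.mk η ≫ g = BialgCat.Hom.mk η ≫ g') : g = g' := by
    let φ : Q →ₐc[k] X := g.toBialgHom
    let φ' : Q →ₐc[k] X := g'.toBialgHom
    have := hη X (φ : Q →ₐ[k] X) (φ' : Q →ₐ[k] X) fun b => congr(($hg).toBialgHom b)
    exact BialgCat.hom_ext _ _ (BialgHom.ext fun x => congr($this x))
  refine ⟨HopfAlgCat.of k Q, ⟨η⟩, ⟨hepi⟩, fun X f => ?_⟩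
  refine existsUnique_of_exists_of_unique ?_ fun g g' hg hg' => ?_
  · obtain ⟨g, hg⟩ := h X (flagBijective_false k X) f.toBialgHom
    exact ⟨⟨g⟩, BialgCat.hom_ext _ _ hg⟩
  · exact (hopfInclusion k).map_injective (hepi _ _ (hg.trans hg'.symm))

theorem exists_hopf_coenvelope (B : BialgCat.{u} k) :
    ∃ (Q : HopfAlgCat.{u} k) (ε : (hopfInclusion k).obj Q ⟶ B),
      ∀ (X : HopfAlgCat.{u} k) (f : (hopfInclusion k).obj X ⟶ B),
        ∃! g : X ⟶ Q, (hopfInclusion k).map g ≫ ε = f := by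
  obtain ⟨Q, _, _, ε, -, h⟩ := exists_coenvelope (k := k) false B
  refine ⟨HopfAlgCat.of k Q, ⟨ε⟩, fun X f => ?_⟩
  obtain ⟨g, hg, huniq⟩ := h X (flagBijective_false k X) f.toBialgHom
  exact ⟨⟨g⟩, BialgCat.hom_ext _ _ hg, fun g' hg' =>
    HopfAlgCat.hom_ext _ _ (huniq _ congr(($hg').toBialgHom))⟩

theorem exists_shopf_envelope (B : HopfAlgCat.{u} k) :
    ∃ (Q : SHopfAlgCat k) (η : B ⟶ (shopfInclusion k).obj Q), Epi η ∧
      ∀ (X : SHopfAlgCat k) (f : B ⟶ (shopfInclusion k).obj X),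
        ∃! g : Q ⟶ X, η ≫ (shopfInclusion k).map g = f := by
  obtain ⟨Q, _, _, η, hQ, h, hη⟩ := exists_envelope (k := k) true B
  have hepi {X : HopfAlgCat.{u} k} (g g' : HopfAlgCat.of k Q ⟶ X)
      (hg : HopfAlgCat.Hom.mk η ≫ g = HopfAlgCat.Hom.mk η ≫ g') : g = g' := by
    have := hη X (g.toBialgHom : Q →ₐ[k] X) (g'.toBialgHom : Q →ₐ[k] X)
      fun b => congr(($hg).toBialgHom b)
    exact HopfAlgCat.hom_ext _ _ (BialgHom.ext fun x => congr($this x))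
  refine ⟨⟨HopfAlgCat.of k Q, hQ rfl⟩, ⟨η⟩, ⟨hepi⟩, fun X f => ?_⟩
  refine existsUnique_of_exists_of_unique ?_ fun g g' hg hg' => ?_
  · obtain ⟨g, hg⟩ := h X.obj (fun _ => X.property) f.toBialgHom
    exact ⟨ObjectProperty.homMk ⟨g⟩, HopfAlgCat.hom_ext _ _ hg⟩
  · exact (shopfInclusion k).map_injective (hepi _ _ (hg.trans hg'.symm))

theorem exists_shopf_coenvelope (B : HopfAlgCat.{u} k) :
    ∃ (Q : SHopfAlgCat k) (ε : (shopfInclusion k).obj Q ⟶ B),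
      ∀ (X : SHopfAlgCat k) (f : (shopfInclusion k).obj X ⟶ B),
        ∃! g : X ⟶ Q, (shopfInclusion k).map g ≫ ε = f := by
  obtain ⟨Q, _, _, ε, hQ, h⟩ := exists_coenvelope (k := k) true B
  refine ⟨⟨HopfAlgCat.of k Q, hQ rfl⟩, ⟨ε⟩, fun X f => ?_⟩
  obtain ⟨g, hg, huniq⟩ := h X.obj (fun _ => X.property) f.toBialgHom
  exact ⟨ObjectProperty.homMk ⟨g⟩, HopfAlgCat.hom_ext _ _ hg, fun g' hg' =>
    ObjectProperty.hom_ext _ (HopfAlgCat.hom_ext _ _ (huniq _ congr(($hg').toBialgHom)))⟩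

variable (k)

theorem hopfInclusion_isRightAdjoint : (hopfInclusion k).IsRightAdjoint :=
  (hopfInclusion k).isRightAdjoint_of_exists_universal fun B =>
    let ⟨Q, η, _, h⟩ := exists_hopf_envelope B
    ⟨Q, η, h⟩

theorem shopfInclusion_isRightAdjoint : (shopfInclusion k).IsRightAdjoint :=
  (shopfInclusion k).isRightAdjoint_of_exists_universal fun B =>
    let ⟨Q, η, _, h⟩ := exists_shopf_envelope B
    ⟨Q, η, h⟩

theorem hopfInclusion_isLeftAdjoint : (hopfInclusion k).IsLeftAdjoint :=
  (hopfInclusion k).isLeftAdjoint_of_exists_universal exists_hopf_coenvelope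

theorem shopfInclusion_isLeftAdjoint : (shopfInclusion k).IsLeftAdjoint :=
  (shopfInclusion k).isLeftAdjoint_of_exists_universal exists_shopf_coenvelope

variable {k}

theorem epi_hopf_unit {L : BialgCat.{u} k ⥤ HopfAlgCat.{u} k} (adj : L ⊣ hopfInclusion k)
    (B : BialgCat.{u} k) : Epi (adj.unit.app B) := by
  obtain ⟨Q, η, _, h⟩ := exists_hopf_envelope B
  obtain ⟨g, hg, -⟩ := h _ (adj.unit.app B)
  exact adj.epi_unit_app_of_epi η g hg

theorem epi_shopf_unit {L : HopfAlgCat.{u} k ⥤ SHopfAlgCat k} (adj : L ⊣ shopfInclusion k)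
    (B : HopfAlgCat.{u} k) : Epi (adj.unit.app B) := by
  obtain ⟨Q, η, _, h⟩ := exists_shopf_envelope B
  obtain ⟨g, hg, -⟩ := h _ (adj.unit.app B)
  exact adj.epi_unit_app_of_epi η g hg

theorem mono_hopf_counit {R : BialgCat.{u} k ⥤ HopfAlgCat.{u} k} (adj : hopfInclusion k ⊣ R)
    (B : BialgCat.{u} k) : Mono (adj.counit.app B) :=
  have := hopfInclusion_isRightAdjoint k
  (Adjunction.ofIsRightAdjoint (hopfInclusion k)).mono_counit_app_of_epi_unit adj
    (epi_hopf_unit _) B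

theorem mono_shopf_counit {R : HopfAlgCat.{u} k ⥤ SHopfAlgCat k} (adj : shopfInclusion k ⊣ R)
    (B : HopfAlgCat.{u} k) : Mono (adj.counit.app B) :=
  have := shopfInclusion_isRightAdjoint k
  (Adjunction.ofIsRightAdjoint (shopfInclusion k)).mono_counit_app_of_epi_unit adj
    (epi_shopf_unit _) B

end Transfer

end

/-! ### The main theorem -/

theorem mainTheorem4 (k : Type u) [Field k] :
    -- the adjoints `H^*`, `H_*` of `j` and `K^*`, `K_*` of `i` exist
    ((hopfInclusion k).IsRightAdjoint ∧ (hopfInclusion k).IsLeftAdjoint ∧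
      (shopfInclusion k).IsRightAdjoint ∧ (shopfInclusion k).IsLeftAdjoint) ∧
    -- (a), the unit `B → H^*(B)`
    (∀ (Hstar : BialgCat.{u} k ⥤ HopfAlgCat.{u} k) (adj : Hstar ⊣ hopfInclusion k)
      (B : BialgCat.{u} k),
      ¬ IsHopf k B →
      (∃ (H : HopfAlgCat.{u} k) (f : B ⟶ (hopfInclusion k).obj H),
        Function.Injective f.toBialgHom) →
      Function.Injective (adj.unit.app B).toBialgHom ∧
      ¬ Function.Surjective (adj.unit.app B).toBialgHom ∧
      Epi (adj.unit.app B)) ∧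
    -- (a), the counit `H_*(B) → B`
    (∀ (Hcostar : BialgCat.{u} k ⥤ HopfAlgCat.{u} k) (adj : hopfInclusion k ⊣ Hcostar)
      (B : BialgCat.{u} k),
      ¬ IsHopf k B →
      (∃ (H : HopfAlgCat.{u} k) (f : (hopfInclusion k).obj H ⟶ B),
        Function.Surjective f.toBialgHom) →
      Function.Surjective (adj.counit.app B).toBialgHom ∧
      ¬ Function.Injective (adj.counit.app B).toBialgHom ∧
      Mono (adj.counit.app B)) ∧
    -- (b), the unit `H → K^*(H)`
    (∀ (Kstar : HopfAlgCat.{u} k ⥤ SHopfAlgCat k) (adj : Kstar ⊣ shopfInclusion k)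
      (H : HopfAlgCat.{u} k),
      ¬ HasBijectiveAntipode k H →
      (∃ (K : SHopfAlgCat k) (f : H ⟶ (shopfInclusion k).obj K),
        Function.Injective f.toBialgHom) →
      Function.Injective (adj.unit.app H).toBialgHom ∧
      ¬ Function.Surjective (adj.unit.app H).toBialgHom ∧
      Epi (adj.unit.app H)) ∧
    -- (b), the counit `K_*(H) → H`
    (∀ (Kcostar : HopfAlgCat.{u} k ⥤ SHopfAlgCat k) (adj : shopfInclusion k ⊣ Kcostar)
      (H : HopfAlgCat.{u} k),
      ¬ HasBijectiveAntipode k H →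
      (∃ (K : SHopfAlgCat k) (f : (shopfInclusion k).obj K ⟶ H),
        Function.Surjective f.toBialgHom) →
      Function.Surjective (adj.counit.app H).toBialgHom ∧
      ¬ Function.Injective (adj.counit.app H).toBialgHom ∧
      Mono (adj.counit.app H)) := by
  refine ⟨⟨hopfInclusion_isRightAdjoint k, hopfInclusion_isLeftAdjoint k,
    shopfInclusion_isRightAdjoint k, shopfInclusion_isLeftAdjoint k⟩,
    fun L adj B hB hf => ?_, fun R adj B hB hf => ?_, fun L adj H hH hf => ?_,
    fun R adj H hH hf => ?_⟩
  · obtain ⟨H, f, hf⟩ := hf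
    have hinj : Function.Injective (adj.unit.app B).toBialgHom := by
      have h : adj.unit.app B ≫ (hopfInclusion k).map ((adj.homEquiv B H).symm f) = f :=
        (adj.homEquiv_unit ..).symm.trans (Equiv.apply_symm_apply _ _)
      rw [← h] at hf
      exact fun _ _ hab => hf (congrArg
        ((hopfInclusion k).map ((adj.homEquiv B H).symm f)).toBialgHom hab)
    refine ⟨hinj, fun hsurj => hB ?_, epi_hopf_unit adj B⟩
    -- A bijective unit would be an isomorphism, pulling the antipode of the envelope back to B.
    exact isHopf_of_bialgEquiv (H := L.obj B)
      (BialgEquiv.ofBijective (adj.unit.app B).toBialgHom ⟨hinj, hsurj⟩)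
  · obtain ⟨H, f, hf⟩ := hf
    have hsurj : Function.Surjective (adj.counit.app B).toBialgHom := by
      have h : (hopfInclusion k).map (adj.homEquiv H B f) ≫ adj.counit.app B = f :=
        (adj.homEquiv_counit ..).symm.trans (Equiv.symm_apply_apply _ _)
      rw [← h] at hf
      exact Function.Surjective.of_comp hf
    refine ⟨hsurj, fun hinj => hB ?_, mono_hopf_counit adj B⟩
    exact isHopf_of_bialgEquiv (H := R.obj B)
      (BialgEquiv.ofBijective (adj.counit.app B).toBialgHom ⟨hinj, hsurj⟩).symm
  · obtain ⟨K, f, hf⟩ := hf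
    have hinj : Function.Injective (adj.unit.app H).toBialgHom := by
      have h : adj.unit.app H ≫ (shopfInclusion k).map ((adj.homEquiv H K).symm f) = f :=
        (adj.homEquiv_unit ..).symm.trans (Equiv.apply_symm_apply _ _)
      rw [← h] at hf
      exact fun _ _ hab => hf (congrArg
        ((shopfInclusion k).map ((adj.homEquiv H K).symm f)).toBialgHom hab)
    refine ⟨hinj, fun hsurj => hH ?_, epi_shopf_unit adj H⟩
    let e : H ≃ₐc[k] (L.obj H).obj :=
      BialgEquiv.ofBijective (adj.unit.app H).toBialgHom ⟨hinj, hsurj⟩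
    exact bijective_antipode_of_bijective (e.symm : (L.obj H).obj →ₐc[k] H)
      e.symm.bijective (L.obj H).property
  · obtain ⟨K, f, hf⟩ := hf
    have hsurj : Function.Surjective (adj.counit.app H).toBialgHom := by
      have h : (shopfInclusion k).map (adj.homEquiv K H f) ≫ adj.counit.app H = f :=
        (adj.homEquiv_counit ..).symm.trans (Equiv.symm_apply_apply _ _)
      rw [← h] at hf
      exact Function.Surjective.of_comp hf
    refine ⟨hsurj, fun hinj => hH ?_, mono_shopf_counit adj H⟩
    exact bijective_antipode_of_bijective (H := (R.obj H).obj) (adj.counit.app H).toBialgHom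
      ⟨hinj, hsurj⟩ (R.obj H).property
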